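/- Let $\mathbb{K}=\mathbb{R}$ or $\mathbb{C}$. A quasi-Banach sequence space is a linear space $E$ of sequences $(x_n)_{n\ge 0}$ in $\mathbb{K}$ with a complete quasi-norm $\|\cdot\|_E$ such that $f\in E$ and $|g|\le|f|$ (pointwise) imply $g\in E$ and $\|g\|_E\le\|f\|_E$. For such spaces (or $\ell^p$-spaces, $0<p<\infty$) $X,Y,Z$, the space $Z$ is an interpolation space for the couple $(X,Y)$ if $X\cap Y\subset Z\subset X+Y$ and every linear operator $T:X+Y\to X+Y$ that restricts to a bounded operator $X\to X$ and to a bounded operator $Y\to Y$ also restricts to a bounded operator $Z\to Z$. For a bounded sequence $w$ put $\mu(t,w)=\inf\{s\ge 0:\ \#\{n:|w_n|>s\}\le t\}$, $t>0$, and for bounded sequences $w,z$ write $w\prec\prec_{tl}z$ if $\int_t^\infty\mu(s,w)\,ds\le\int_t^\infty\mu(s,z)\,ds$ for all $t>0$, the integrals being taken in $[0,\infty]$. Let $E\subset\ell_\infty$ be a quasi-Banach sequence space with $E\neq\{0\}$ and $E\neq\ell_\infty$, and let $1\le q<\infty$. The following conditions are equivalent: (a) there exists $p$ with $0<p<q$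 such that $E$ is an interpolation space for the couple $(\ell^p,\ell^q)$; (b) there exists $c>0$ such that for all $u\in E$ and $v\in\ell_\infty$, $|v|^q\prec\prec_{tl}|u|^q$ implies $v\in E$ and $\|v\|_E\le c\|u\|_E$; (c) for all $u\in E$ and $v\in\ell_\infty$, $|v|^q\prec\prec_{tl}|u|^q$ implies $v\in E$. -/

import Mathlib

open scoped ENNReal

noncomputable section

namespace SeqInterp

/-- A linear space of scalar sequences together with a real-valued function on it
(the candidate quasi-norm). -/
structure NormedSeqSpace (𝕜 : Type*) [RCLike 𝕜] where
  carrier : Submodule 𝕜 (ℕ → 𝕜)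
  qnorm : carrier → ℝ

/-- `E` is a quasi-Banach sequence space: `qnorm` is a complete quasi-norm, and `E` is solid,
i.e. `|g| ≤ |f|` pointwise with `f ∈ E` gives `g ∈ E` and `‖g‖ ≤ ‖f‖`. -/
structure NormedSeqSpace.IsQuasiBanach {𝕜 : Type*} [RCLike 𝕜] (E : NormedSeqSpace 𝕜) : Prop where
  nonneg : ∀ x, 0 ≤ E.qnorm x
  eq_zero_iff : ∀ x, E.qnorm x = 0 ↔ x = 0
  smul : ∀ (a : 𝕜) (x), E.qnorm (a • x) = ‖a‖ * E.qnorm x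
  add_le : ∃ C : ℝ, ∀ x y, E.qnorm (x + y) ≤ C * (E.qnorm x + E.qnorm y)
  complete : ∀ f : ℕ → E.carrier,
    (∀ ε > 0, ∃ N, ∀ m ≥ N, ∀ n ≥ N, E.qnorm (f m - f n) < ε) →
      ∃ x, Filter.Tendsto (fun n => E.qnorm (f n - x)) Filter.atTop (nhds 0)
  solid : ∀ (f : E.carrier) (g : ℕ → 𝕜), (∀ n, ‖g n‖ ≤ ‖(f : ℕ → 𝕜) n‖) →
    ∃ hg : g ∈ E.carrier, E.qnorm ⟨g, hg⟩ ≤ E.qnorm f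

/-- The sequence space `ℓ^p` with Mathlib's (quasi-)norm. -/
def ellp (𝕜 : Type*) [RCLike 𝕜] (p : ℝ≥0∞) : NormedSeqSpace 𝕜 where
  carrier :=
    { carrier := {x | Memℓp x p}
      add_mem' := fun hx hy => hx.add hy
      zero_mem' := zero_memℓp
      smul_mem' := fun a _ hx => hx.const_smul a }
  qnorm := fun x => ‖(⟨x.1, x.2⟩ : lp (fun _ : ℕ => 𝕜) p)‖

/-- A linear operator `T` defined on a space `V` of sequences restricts to a bounded operator
from `Z` to `Z`. -/
def RestrictsBounded {𝕜 : Type*} [RCLike 𝕜] {V : Submodule 𝕜 (ℕ → 𝕜)} (T : V →ₗ[𝕜] V)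
    (Z : NormedSeqSpace 𝕜) : Prop :=
  ∃ C : ℝ, ∀ (x : V) (hx : (x : ℕ → 𝕜) ∈ Z.carrier),
    ∃ hT : (T x : ℕ → 𝕜) ∈ Z.carrier, Z.qnorm ⟨T x, hT⟩ ≤ C * Z.qnorm ⟨x, hx⟩

/-- `Z` is an interpolation space for the couple `(X, Y)`: `X ∩ Y ⊆ Z ⊆ X + Y`, and every linear
operator on `X + Y` that restricts to bounded operators on `X` and on `Y` also restricts to a
bounded operator on `Z`. -/
def IsInterpolationSpace {𝕜 : Type*} [RCLike 𝕜] (X Y Z : NormedSeqSpace 𝕜) : Prop :=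
  X.carrier ⊓ Y.carrier ≤ Z.carrier ∧ Z.carrier ≤ X.carrier ⊔ Y.carrier ∧
    ∀ T : ↥(X.carrier ⊔ Y.carrier) →ₗ[𝕜] ↥(X.carrier ⊔ Y.carrier),
      RestrictsBounded T X → RestrictsBounded T Y → RestrictsBounded T Z

/-- The right-continuous decreasing rearrangement
`μ(t, f) = inf {s ≥ 0 : m {|f| > s} ≤ t}` of a function on a measure space. -/
def rearrangement {Ω : Type*} [MeasurableSpace Ω] (m : MeasureTheory.Measure Ω) (f : Ω → ℝ)
    (t : ℝ) : ℝ≥0∞ :=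
  sInf {s : ℝ≥0∞ | m {x | s < ‖f x‖ₑ} ≤ ENNReal.ofReal t}

/-- Tail majorization of `g` by `f`: `∫_t^∞ μ(s, g) ds ≤ ∫_t^∞ μ(s, f) ds` for every `t > 0`,
the integrals being taken in `[0, ∞]`. -/
def TailMajorized {Ω : Type*} [MeasurableSpace Ω] (m : MeasureTheory.Measure Ω)
    (g f : Ω → ℝ) : Prop :=
  ∀ t : ℝ, 0 < t →
    ∫⁻ s in Set.Ioi t, rearrangement m g s ≤ ∫⁻ s in Set.Ioi t, rearrangement m f s

/-- `|v|^q` is tail majorized by `|u|^q`, for sequences, i.e. functions on `ℕ` with the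
counting measure. -/
def TailMajorizedPow {𝕜 : Type*} [RCLike 𝕜] (q : ℝ) (v u : ℕ → 𝕜) : Prop :=
  TailMajorized MeasureTheory.Measure.count (fun n => ‖v n‖ ^ q) (fun n => ‖u n‖ ^ q)

end SeqInterp

end

/-!
For the counting measure, `|v|^q ≺≺_tl |u|^q` means that whatever finite set of terms is deleted
from `∑ |u|^q`, at most as many terms can be deleted from `∑ |v|^q` so as to leave at most as large
a sum. This form passes to direct sums and to rearrangements.

If `u` and `v` are decreasing and `|v| ≥ |u|` on the support of `v`, the monotone coupling of the
masses `|v j|^q` with the masses `|u k|^q` never moves mass to the left. The resulting matrix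
carries `|u|` to `|v|` and is bounded on `ℓ^r` for every `r ≤ q`: by Schur's test for `1 ≤ r`, and
for `r ≤ 1` because monotonicity leaves at most two nonzero entries, each at most `1`, in a column.
An interpolation space of the couple `(ℓ^p, ℓ^q)` is therefore closed under tail majorization.

Closedness implies its uniform version by a direct sum: a sequence of counterexamples with
constants tending to infinity could, after scaling, be assembled into a single one.

Finally let `E ≠ ℓ^∞` be closed under tail majorization, hence contained in `ℓ^q`. Dyadic dilations
are bounded on `E`, so each `u` in `E` has a majorant `y` in `E` which absorbs all dilations of `u`
with geometric weights, and for small `p` the `ℓ^p` means of the `n` largest terms of `|u|` are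
bounded by a multiple of `|y k|` for `n ≤ k < 3 n`. For `T` bounded on `ℓ^p` and on `ℓ^q`, splitting
`u` into its `n` largest terms and the rest shows that `|T u|^q` is tail dominated by a multiple of
`|y|^q`.
-/

namespace SeqInterp

open Filter MeasureTheory Topology
open scoped NNReal

/-! ### Decreasing enumerations and tail sums -/

section Enumeration

variable {ι : Type*} {φ : ι → ℝ≥0∞} {σ : ℕ → ι}

/-- `σ` lists the values of `φ` in decreasing order, each index at most once. Indices may be
missed, but only zeros of `φ`. -/
structure IsDecreasingEnumeration (φ : ι → ℝ≥0∞) (σ : ℕ → ι) : Prop where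
  injective : σ.Injective
  antitone : Antitone (φ ∘ σ)
  eq_zero_of_notMem_range : ∀ k ∉ Set.range σ, φ k = 0

lemma exists_notMem_forall_notMem_le [Infinite ι] (hφ : ∀ ε > 0, {k | ε ≤ φ k}.Finite)
    (F : Finset ι) : ∃ m ∉ F, ∀ k ∉ F, φ k ≤ φ m := by
  by_cases hzero : ∀ k ∉ F, φ k = 0
  · obtain ⟨m, hm⟩ := Infinite.exists_notMem_finset F
    exact ⟨m, hm, fun k hk => (hzero k hk).trans_le zero_le⟩
  · push Not at hzero
    obtain ⟨k₀, hk₀, hpos⟩ := hzero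
    have hfin := (hφ (φ k₀) (pos_iff_ne_zero.2 hpos)).inter_of_left {k | k ∉ F}
    obtain ⟨m, hm, hmax⟩ := Set.exists_max_image _ φ hfin ⟨k₀, le_refl (φ k₀), hk₀⟩
    refine ⟨m, hm.2, fun k hk => ?_⟩
    rcases le_total (φ k₀) (φ k) with hle | hle
    · exact hmax k ⟨hle, hk⟩
    · exact hle.trans hm.1

lemma exists_isDecreasingEnumeration [Infinite ι] (hφ : ∀ ε > 0, {k | ε ≤ φ k}.Finite) :
    ∃ σ, IsDecreasingEnumeration φ σ := by
  classical
  choose next next_notMem le_next using exists_notMem_forall_notMem_le hφ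
  let used : ℕ → Finset ι := fun n => (fun F => insert (next F) F)^[n] ∅
  have used_succ (n : ℕ) : used (n + 1) = insert (next (used n)) (used n) :=
    Function.iterate_succ_apply' _ _ _
  have used_mono : Monotone used := monotone_nat_of_le_succ fun n => by
    rw [used_succ]; exact Finset.subset_insert _ _
  have next_mem {m n : ℕ} (h : m < n) : next (used m) ∈ used n :=
    used_mono (Nat.succ_le_of_lt h) (by rw [used_succ]; exact Finset.mem_insert_self _ _)
  have hinj : Function.Injective fun n => next (used n) :=
    Function.Injective.of_lt_imp_ne fun m n hmn he => next_notMem _ (he ▸ next_mem hmn)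
  refine ⟨fun n => next (used n), hinj, antitone_nat_of_succ_le fun n => le_next _ _ fun h =>
    next_notMem _ (used_mono n.le_succ h), fun k hk => ?_⟩
  have notMem_used (n : ℕ) : k ∉ used n := by
    induction n with
    | zero => exact Finset.notMem_empty k
    | succ n ih =>
      rw [used_succ, Finset.mem_insert, not_or]
      exact ⟨fun he => hk ⟨n, he.symm⟩, ih⟩
  by_contra hne
  refine Set.infinite_range_of_injective hinj ((hφ _ (pos_iff_ne_zero.2 hne)).subset ?_)
  rintro _ ⟨n, rfl⟩
  exact le_next _ k (notMem_used n)

end Enumeration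

section TailSums

variable {ι κ J : Type*}

/-- The sum of `φ` over the complement of the finite set `F`. -/
noncomputable def sumOff (φ : ι → ℝ≥0∞) (F : Finset ι) : ℝ≥0∞ :=
  ∑' k, ((F : Set ι)ᶜ).indicator φ k

/-- Combinatorial form of tail majorization, which makes sense for families with different index
types: whatever remains of `φ` after deleting finitely many terms dominates what remains of `ψ`
after deleting at most as many suitable terms. -/
def TailDominated (ψ : κ → ℝ≥0∞) (φ : ι → ℝ≥0∞) : Prop :=
  ∀ F : Finset ι, ∃ G : Finset κ, G.card ≤ F.card ∧ sumOff ψ G ≤ sumOff φ F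

@[simp]
lemma sumOff_empty (φ : ι → ℝ≥0∞) : sumOff φ ∅ = ∑' k, φ k := by
  simp [sumOff]

lemma sum_add_sumOff (φ : ι → ℝ≥0∞) (F : Finset ι) :
    ∑ k ∈ F, φ k + sumOff φ F = ∑' k, φ k := by
  rw [sumOff, ← tsum_subtype ((F : Set ι)ᶜ) φ]
  exact ENNReal.sum_add_tsum_compl F φ

lemma sumOff_mono_left {φ ψ : ι → ℝ≥0∞} (h : ψ ≤ φ) (F : Finset ι) : sumOff ψ F ≤ sumOff φ F :=
  ENNReal.tsum_le_tsum fun _ => Set.indicator_le_indicator (h _)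

lemma sumOff_le_tsum (φ : ι → ℝ≥0∞) (F : Finset ι) : sumOff φ F ≤ ∑' k, φ k :=
  ENNReal.tsum_le_tsum fun _ => Set.indicator_le_self _ _ _

lemma sumOff_eq_top_of_infinite {φ : ι → ℝ≥0∞} {ε : ℝ≥0∞} (hε : 0 < ε)
    (h : {k | ε ≤ φ k}.Infinite) (F : Finset ι) : sumOff φ F = ∞ := by
  by_contra hne
  have hfin := ENNReal.finite_const_le_of_tsum_ne_top hne hε.ne'
  refine h ((hfin.union F.finite_toSet).subset fun k hk => ?_)
  by_cases hkF : k ∈ F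
  · exact Or.inr hkF
  · exact Or.inl (by simpa [hkF] using hk)

lemma sumOff_range (x : ℕ → ℝ≥0∞) (n : ℕ) :
    sumOff x (Finset.range n) = ∑' i, x (i + n) := by
  rw [sumOff, ← Summable.sum_add_tsum_nat_add' (k := n) ENNReal.summable, Finset.sum_eq_zero,
    zero_add]
  · exact tsum_congr fun i => by simp
  · intro i hi
    simp [Finset.mem_range.1 hi]

lemma sumOff_eq_sum_sdiff_add [DecidableEq ι] (φ : ι → ℝ≥0∞) (F G : Finset ι) :
    sumOff φ F = ∑ k ∈ G \ F, φ k + sumOff φ (F ∪ G) := by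
  rw [sumOff, sumOff, sum_eq_tsum_indicator, ← ENNReal.tsum_add]
  refine tsum_congr fun k => ?_
  by_cases hF : k ∈ F <;> by_cases hG : k ∈ G <;> simp [hF, hG]

lemma sumOff_range_le_sumOff {x : ℕ → ℝ≥0∞} (hx : Antitone x) {n : ℕ} {G : Finset ℕ}
    (hG : G.card ≤ n) : sumOff x (Finset.range n) ≤ sumOff x G := by
  rw [sumOff_eq_sum_sdiff_add x (Finset.range n) G, sumOff_eq_sum_sdiff_add x G (Finset.range n),
    Finset.union_comm]
  gcongr ?_ + _
  have hcard : (G \ Finset.range n).card ≤ (Finset.range n \ G).card :=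
    Finset.card_sdiff_le_card_sdiff_iff.2 (by simpa using hG)
  calc ∑ k ∈ G \ Finset.range n, x k ≤ (G \ Finset.range n).card • x n :=
        Finset.sum_le_card_nsmul _ _ _ fun k hk => hx (by simpa using (Finset.mem_sdiff.1 hk).2)
    _ ≤ (Finset.range n \ G).card • x n := by gcongr
    _ ≤ ∑ k ∈ Finset.range n \ G, x k :=
        Finset.card_nsmul_le_sum _ _ _ fun k hk =>
          hx (by simpa using (Finset.mem_range.1 (Finset.mem_sdiff.1 hk).1).le)

lemma TailDominated.trans {χ : J → ℝ≥0∞} {ψ : κ → ℝ≥0∞} {φ : ι → ℝ≥0∞}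
    (h₁ : TailDominated χ ψ) (h₂ : TailDominated ψ φ) : TailDominated χ φ := fun F => by
  obtain ⟨G, hG, hle⟩ := h₂ F
  obtain ⟨H, hH, hle'⟩ := h₁ G
  exact ⟨H, hH.trans hG, hle'.trans hle⟩

lemma TailDominated.tsum_le {ψ : κ → ℝ≥0∞} {φ : ι → ℝ≥0∞} (h : TailDominated ψ φ) :
    ∑' k, ψ k ≤ ∑' k, φ k := by
  obtain ⟨G, hG, hle⟩ := h ∅
  obtain rfl : G = ∅ := by simpa using hG
  rwa [sumOff_empty, sumOff_empty] at hle

lemma sumOff_const_mul (c : ℝ≥0∞) (φ : ι → ℝ≥0∞) (F : Finset ι) :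
    sumOff (fun k => c * φ k) F = c * sumOff φ F := by
  simp only [sumOff, Set.indicator_const_mul, ENNReal.tsum_mul_left]

lemma TailDominated.const_mul {ψ : κ → ℝ≥0∞} {φ : ι → ℝ≥0∞} (h : TailDominated ψ φ)
    (c : ℝ≥0∞) : TailDominated (fun k => c * ψ k) fun k => c * φ k := fun F => by
  obtain ⟨G, hG, hle⟩ := h F
  refine ⟨G, hG, ?_⟩
  rw [sumOff_const_mul, sumOff_const_mul]
  gcongr

lemma tailDominated_comp (φ : ι → ℝ≥0∞) {τ : κ → ι} (hτ : τ.Injective) :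
    TailDominated (φ ∘ τ) φ := fun F => by
  classical
  refine ⟨F.preimage τ hτ.injOn, ?_, ?_⟩
  · exact (Finset.card_preimage ..).trans_le (Finset.card_filter_le ..)
  · calc sumOff (φ ∘ τ) (F.preimage τ hτ.injOn)
        = ∑' k, ((F : Set ι)ᶜ).indicator φ (τ k) := tsum_congr fun k => by
          by_cases hk : τ k ∈ F <;> simp [hk]
      _ ≤ sumOff φ F := ENNReal.tsum_comp_le_tsum_of_injective hτ _

lemma sumOff_map {φ : ι → ℝ≥0∞} (τ : κ ↪ ι) (h0 : ∀ k ∉ Set.range τ, φ k = 0) (F : Finset κ) :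
    sumOff φ (F.map τ) = sumOff (φ ∘ τ) F := by
  have hsupp : Function.support (((F.map τ : Set ι)ᶜ).indicator φ) ⊆ Set.range τ :=
    fun k hk => by_contra fun hn => hk (by simp [Set.indicator, h0 k hn])
  rw [sumOff, ← τ.injective.tsum_eq hsupp]
  exact tsum_congr fun k => by by_cases hk : k ∈ F <;> simp [hk]

lemma tailDominated_of_comp {φ : ι → ℝ≥0∞} {τ : κ → ι} (hτ : τ.Injective)
    (h0 : ∀ k ∉ Set.range τ, φ k = 0) : TailDominated φ (φ ∘ τ) := fun F =>
  ⟨F.map ⟨τ, hτ⟩, (F.card_map _).le, (sumOff_map ⟨τ, hτ⟩ h0 F).le⟩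

lemma sumOff_sigma {ι : J → Type*} (φ : ∀ j, ι j → ℝ≥0∞) {I : Finset J}
    {F : ∀ j, Finset (ι j)} (hF : ∀ j ∉ I, F j = ∅) :
    sumOff (fun r : Σ j, ι j => φ r.1 r.2) (I.sigma F) = ∑' j, sumOff (φ j) (F j) := by
  rw [sumOff, ENNReal.tsum_sigma']
  refine tsum_congr fun j => tsum_congr fun k => ?_
  by_cases hk : k ∈ F j
  · have hj : j ∈ I := by_contra fun hj => by simp [hF j hj] at hk
    simp [hj, hk]
  · simp [hk]

lemma tailDominated_sigma {ι κ : J → Type*} {ψ : ∀ j, κ j → ℝ≥0∞} {φ : ∀ j, ι j → ℝ≥0∞}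
    (h : ∀ j, TailDominated (ψ j) (φ j)) :
    TailDominated (fun r : Σ j, κ j => ψ r.1 r.2) fun r : Σ j, ι j => φ r.1 r.2 := fun F => by
  classical
  let fiber (j : J) : Finset (ι j) := F.preimage (Sigma.mk j) sigma_mk_injective.injOn
  choose G hcard hle using fun j => h j (fiber j)
  have hF : (F.image Sigma.fst).sigma fiber = F := Finset.sigma_image_fst_preimage_mk F
  have fiber_eq_empty (j : J) (hj : j ∉ F.image Sigma.fst) : fiber j = ∅ := by
    simpa [fiber, Finset.eq_empty_iff_forall_notMem] using hj
  have G_eq_empty (j : J) (hj : j ∉ F.image Sigma.fst) : G j = ∅ := by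
    simpa [fiber_eq_empty j hj] using hcard j
  refine ⟨(F.image Sigma.fst).sigma G, ?_, ?_⟩
  · rw [← hF, Finset.card_sigma, Finset.card_sigma, hF]
    exact Finset.sum_le_sum fun j _ => hcard j
  · rw [← hF, sumOff_sigma φ fiber_eq_empty, hF, sumOff_sigma ψ G_eq_empty]
    exact ENNReal.tsum_le_tsum hle

lemma tailDominated_iff_of_antitone {x y : ℕ → ℝ≥0∞} (hy : Antitone y) (hx : Antitone x) :
    TailDominated y x ↔ ∀ n, ∑' i, y (i + n) ≤ ∑' i, x (i + n) := by
  simp only [← sumOff_range]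
  constructor
  · intro h n
    obtain ⟨G, hG, hle⟩ := h (Finset.range n)
    exact (sumOff_range_le_sumOff hy (by simpa using hG)).trans hle
  · exact fun h F => ⟨Finset.range F.card, by simp, (h _).trans (sumOff_range_le_sumOff hx le_rfl)⟩

end TailSums

/-! ### Decreasing rearrangement for the counting measure -/

section Rearrangement

variable {ι : Type*} [MeasurableSpace ι]

lemma antitone_rearrangement {m : Measure ι} (f : ι → ℝ) : Antitone (rearrangement m f) :=
  fun _ _ hst => sInf_le_sInf fun _ h => le_trans h (ENNReal.ofReal_le_ofReal hst)

lemma le_rearrangement_count_of_infinite {f : ι → ℝ} {ε : ℝ≥0∞} (h : {k | ε ≤ ‖f k‖ₑ}.Infinite)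
    (t : ℝ) : ε ≤ rearrangement Measure.count f t := by
  refine le_sInf fun s hs => ?_
  by_contra! hlt
  have hinf : {k | s < ‖f k‖ₑ}.Infinite := h.mono fun k hk => hlt.trans_le hk
  simp [Measure.count_apply_infinite hinf] at hs

variable [MeasurableSingletonClass ι]

lemma rearrangement_count_floor (f : ι → ℝ) {t : ℝ} (ht : 0 ≤ t) :
    rearrangement Measure.count f (⌊t⌋₊ : ℝ) = rearrangement Measure.count f t := by
  unfold rearrangement
  congr 1
  ext s
  simp only [Set.mem_ofPred_eq, ENNReal.ofReal_natCast]
  rcases Set.finite_or_infinite {x | s < ‖f x‖ₑ} with hA | hA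
  · rw [Measure.count_apply_finite _ hA, ← ENNReal.ofReal_natCast,
      ENNReal.ofReal_le_ofReal_iff ht, ENNReal.ofReal_natCast, Nat.cast_le, Nat.le_floor_iff ht]
  · simp [Measure.count_apply_infinite hA]

lemma IsDecreasingEnumeration.rearrangement_count {f : ι → ℝ} {σ : ℕ → ι}
    (hσ : IsDecreasingEnumeration (fun k => ‖f k‖ₑ) σ) (n : ℕ) :
    rearrangement Measure.count f n = ‖f (σ n)‖ₑ := by
  classical
  refine le_antisymm (sInf_le ?_) (le_sInf fun s hs => ?_)
  · have hsub : {k | ‖f (σ n)‖ₑ < ‖f k‖ₑ} ⊆ ((Finset.range n).image σ : Finset ι) := by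
      intro k hk
      obtain ⟨i, rfl⟩ : k ∈ Set.range σ := by
        by_contra hn
        simp [hσ.eq_zero_of_notMem_range k hn] at hk
      have hi : i < n := lt_of_not_ge fun hi => (hσ.antitone hi).not_gt hk
      simpa using ⟨i, hi, rfl⟩
    refine (measure_mono hsub).trans ?_
    rw [Measure.count_apply_finset, ENNReal.ofReal_natCast]
    exact_mod_cast Finset.card_image_le.trans (by simp)
  · by_contra! hlt
    have hsub : (((Finset.range (n + 1)).image σ : Finset ι) : Set ι) ⊆ {k | s < ‖f k‖ₑ} := by
      intro k hk
      obtain ⟨i, hi, rfl⟩ := Finset.mem_image.1 (Finset.mem_coe.1 hk)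
      exact hlt.trans_le (hσ.antitone (Finset.mem_range_succ_iff.1 hi))
    have := (measure_mono hsub).trans hs
    rw [Measure.count_apply_finset, ENNReal.ofReal_natCast, Nat.cast_le,
      Finset.card_image_of_injective _ hσ.injective, Finset.card_range] at this
    omega

lemma tailDominated_rearrangement_count [Infinite ι] (f : ι → ℝ) :
    TailDominated (fun n : ℕ => rearrangement Measure.count f n) (fun k => ‖f k‖ₑ) ∧
      TailDominated (fun k => ‖f k‖ₑ) fun n : ℕ => rearrangement Measure.count f n := by
  by_cases h : ∀ ε > 0, {k | ε ≤ ‖f k‖ₑ}.Finite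
  · obtain ⟨σ, hσ⟩ := exists_isDecreasingEnumeration h
    simp only [hσ.rearrangement_count]
    exact ⟨tailDominated_comp _ hσ.injective,
      tailDominated_of_comp hσ.injective hσ.eq_zero_of_notMem_range⟩
  · push Not at h
    obtain ⟨ε, hε, hinf⟩ := h
    have hinf' : {n : ℕ | ε ≤ rearrangement Measure.count f n}.Infinite := by
      simpa [le_rearrangement_count_of_infinite hinf] using Set.infinite_univ
    exact ⟨fun F => ⟨∅, by simp, by simp [sumOff_eq_top_of_infinite hε hinf]⟩,
      fun F => ⟨∅, by simp, by simp [sumOff_eq_top_of_infinite hε hinf']⟩⟩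

lemma setLIntegral_Ico_floor (h : ℕ → ℝ≥0∞) {m : ℕ} {a : ℝ} (ha : m ≤ a) :
    ∫⁻ s in Set.Ico a (m + 1), h ⌊s⌋₊ = ENNReal.ofReal (m + 1 - a) * h m := by
  rw [setLIntegral_congr_fun measurableSet_Ico (g := fun _ => h m), setLIntegral_const,
    Real.volume_Ico, mul_comm]
  intro s hs
  have hfloor : ⌊s⌋₊ = m := (Nat.floor_eq_iff (m.cast_nonneg.trans (ha.trans hs.1))).2
    ⟨ha.trans hs.1, hs.2⟩
  simp only [hfloor]

lemma setLIntegral_Ici_floor (h : ℕ → ℝ≥0∞) (m : ℕ) :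
    ∫⁻ s in Set.Ici (m : ℝ), h ⌊s⌋₊ = ∑' i, h (i + m) := by
  have hunion : Set.Ici (m : ℝ) = ⋃ i : ℕ, Set.Ico ((i + m : ℕ) : ℝ) ((i + m : ℕ) + 1) := by
    ext s
    simp only [Set.mem_Ici, Set.mem_iUnion, Set.mem_Ico]
    constructor
    · intro hs
      refine ⟨⌊s⌋₊ - m, ?_⟩
      rw [Nat.sub_add_cancel (Nat.le_floor hs)]
      exact ⟨Nat.floor_le (m.cast_nonneg.trans hs), Nat.lt_floor_add_one s⟩
    · rintro ⟨i, hi, -⟩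
      exact (Nat.cast_le.2 (Nat.le_add_left m i)).trans hi
  rw [hunion, lintegral_iUnion fun _ => measurableSet_Ico]
  · exact tsum_congr fun i => by rw [setLIntegral_Ico_floor h le_rfl]; simp
  · intro i j hij
    refine Set.disjoint_left.2 fun s hi hj => hij ?_
    have hs : 0 ≤ s := (Nat.cast_nonneg _).trans hi.1
    have := (Nat.floor_eq_iff hs).2 ⟨hi.1, hi.2⟩
    have := (Nat.floor_eq_iff hs).2 ⟨hj.1, hj.2⟩
    omega

lemma setLIntegral_Ioi_floor (h : ℕ → ℝ≥0∞) {n : ℕ} {t : ℝ} (h₁ : n ≤ t) (h₂ : t ≤ n + 1) :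
    ∫⁻ s in Set.Ioi t, h ⌊s⌋₊ = ENNReal.ofReal (n + 1 - t) * ∑' i, h (i + n) +
      ENNReal.ofReal (t - n) * ∑' i, h (i + (n + 1)) := by
  have hweights : ENNReal.ofReal (n + 1 - t) + ENNReal.ofReal (t - n) = 1 := by
    rw [← ENNReal.ofReal_add (by linarith) (by linarith)]
    simp
  have hhead : ∑' i, h (i + n) = h n + ∑' i, h (i + (n + 1)) := by
    rw [tsum_eq_zero_add' ENNReal.summable, zero_add]
    simp only [add_assoc, add_comm 1]
  have htail := setLIntegral_Ici_floor h (n + 1)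
  push_cast at htail
  rw [setLIntegral_congr Ioi_ae_eq_Ici, ← Set.Ico_union_Ici_eq_Ici h₂,
    lintegral_union measurableSet_Ici
      (Set.disjoint_left.2 fun s hs hs' => not_lt.2 hs' hs.2),
    setLIntegral_Ico_floor h h₁, htail, hhead, mul_add, add_assoc, ← add_mul, hweights, one_mul]

lemma forall_setLIntegral_Ioi_floor_le_iff (g h : ℕ → ℝ≥0∞) :
    (∀ t : ℝ, 0 < t → ∫⁻ s in Set.Ioi t, g ⌊s⌋₊ ≤ ∫⁻ s in Set.Ioi t, h ⌊s⌋₊) ↔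
      ∀ n, ∑' i, g (i + n) ≤ ∑' i, h (i + n) := by
  constructor
  · intro hle n
    have hlim : Tendsto (fun t : ℝ => ENNReal.ofReal (n + 1 - t) * ∑' i, g (i + n)) (𝓝[>] n)
        (𝓝 (ENNReal.ofReal (n + 1 - n) * ∑' i, g (i + n))) :=
      ENNReal.Tendsto.mul_const (tendsto_nhdsWithin_of_tendsto_nhds
        (ENNReal.continuous_ofReal.comp (continuous_const.sub continuous_id)).continuousAt)
        (Or.inl (by simp))
    simp only [add_sub_cancel_left, ENNReal.ofReal_one, one_mul] at hlim
    refine le_of_tendsto hlim ?_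
    filter_upwards [Ioo_mem_nhdsGT (lt_add_one (n : ℝ))] with t ht
    calc ENNReal.ofReal (n + 1 - t) * ∑' i, g (i + n) ≤ ∫⁻ s in Set.Ioi t, g ⌊s⌋₊ := by
          rw [setLIntegral_Ioi_floor g ht.1.le ht.2.le]
          exact le_self_add
      _ ≤ ∫⁻ s in Set.Ioi t, h ⌊s⌋₊ := hle t (n.cast_nonneg.trans_lt ht.1)
      _ ≤ ∫⁻ s in Set.Ici (n : ℝ), h ⌊s⌋₊ :=
          lintegral_mono_set (Set.Ioi_subset_Ici ht.1.le)
      _ = ∑' i, h (i + n) := setLIntegral_Ici_floor h n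
  · intro hle t ht
    have h₁ := Nat.floor_le ht.le
    have h₂ := (Nat.lt_floor_add_one t).le
    rw [setLIntegral_Ioi_floor g h₁ h₂, setLIntegral_Ioi_floor h h₁ h₂]
    gcongr _ * ?_ + _ * ?_ <;> exact hle _

lemma tailMajorized_count_iff [Infinite ι] (g f : ι → ℝ) :
    TailMajorized Measure.count g f ↔ TailDominated (fun k => ‖g k‖ₑ) fun k => ‖f k‖ₑ := by
  have hfloor (f : ι → ℝ) {t : ℝ} (ht : 0 < t) :
      ∫⁻ s in Set.Ioi t, rearrangement Measure.count f s =
        ∫⁻ s in Set.Ioi t, rearrangement Measure.count f (⌊s⌋₊ : ℝ) :=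
    setLIntegral_congr_fun measurableSet_Ioi fun s hs =>
      (rearrangement_count_floor f (ht.trans hs).le).symm
  have hanti (f : ι → ℝ) : Antitone fun n : ℕ => rearrangement Measure.count f n :=
    (antitone_rearrangement f).comp_monotone Nat.mono_cast
  have hsums : TailMajorized Measure.count g f ↔
      TailDominated (fun n : ℕ => rearrangement Measure.count g n)
        fun n : ℕ => rearrangement Measure.count f n := by
    rw [tailDominated_iff_of_antitone (hanti g) (hanti f), ← forall_setLIntegral_Ioi_floor_le_iff
      (fun n => rearrangement Measure.count g n) fun n => rearrangement Measure.count f n]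
    exact forall₂_congr fun t ht => by rw [hfloor g ht, hfloor f ht]
  obtain ⟨hg, hg'⟩ := tailDominated_rearrangement_count g
  obtain ⟨hf, hf'⟩ := tailDominated_rearrangement_count f
  exact hsums.trans ⟨fun h => (hg'.trans h).trans hf, fun h => (hg.trans h).trans hf'⟩

end Rearrangement

section TailDominatedPow

variable {𝕜 : Type*} [RCLike 𝕜]

lemma tailMajorizedPow_iff {q : ℝ} (hq : 0 ≤ q) (v u : ℕ → 𝕜) :
    TailMajorizedPow q v u ↔ TailDominated (fun k => ‖v k‖ₑ ^ q) fun k => ‖u k‖ₑ ^ q := by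
  have henorm (w : ℕ → 𝕜) (k : ℕ) : ‖‖w k‖ ^ q‖ₑ = ‖w k‖ₑ ^ q := by
    rw [Real.enorm_rpow_of_nonneg (norm_nonneg _) hq, enorm_norm]
  simp only [TailMajorizedPow, tailMajorized_count_iff, henorm]

end TailDominatedPow

/-! ### Quasi-Banach sequence spaces -/

section QuasiBanach

variable {𝕜 : Type*} [RCLike 𝕜]

namespace NormedSeqSpace

open Classical in
/-- The quasi-norm of `E`, extended by `0` to all sequences, so that estimates can be written
without membership proofs. It is meaningful on `E` only. -/
noncomputable def extQnorm (E : NormedSeqSpace 𝕜) (x : ℕ → 𝕜) : ℝ :=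
  if h : x ∈ E.carrier then E.qnorm ⟨x, h⟩ else 0

/-- `K` is a constant in the quasi-triangle inequality of `E`, normalized by `1 ≤ K`. -/
structure IsConcavityModulus (E : NormedSeqSpace 𝕜) (K : ℝ) : Prop where
  one_le : 1 ≤ K
  add_le : ∀ x ∈ E.carrier, ∀ y ∈ E.carrier,
    E.extQnorm (x + y) ≤ K * (E.extQnorm x + E.extQnorm y)

lemma extQnorm_of_mem (E : NormedSeqSpace 𝕜) {x : ℕ → 𝕜} (h : x ∈ E.carrier) :
    E.extQnorm x = E.qnorm ⟨x, h⟩ :=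
  dif_pos h

end NormedSeqSpace

namespace NormedSeqSpace.IsQuasiBanach

variable {E : NormedSeqSpace 𝕜}

lemma extQnorm_nonneg (hE : E.IsQuasiBanach) (x : ℕ → 𝕜) : 0 ≤ E.extQnorm x := by
  unfold extQnorm
  split_ifs
  exacts [hE.nonneg _, le_rfl]

lemma extQnorm_zero (hE : E.IsQuasiBanach) : E.extQnorm 0 = 0 := by
  rw [E.extQnorm_of_mem E.carrier.zero_mem, hE.eq_zero_iff]
  rfl

lemma extQnorm_eq_zero_iff (hE : E.IsQuasiBanach) {x : ℕ → 𝕜} (hx : x ∈ E.carrier) :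
    E.extQnorm x = 0 ↔ x = 0 := by
  rw [E.extQnorm_of_mem hx, hE.eq_zero_iff, Submodule.mk_eq_zero]

lemma extQnorm_pos (hE : E.IsQuasiBanach) {x : ℕ → 𝕜} (hx : x ∈ E.carrier) (hx0 : x ≠ 0) :
    0 < E.extQnorm x :=
  (hE.extQnorm_nonneg x).lt_of_ne' fun h => hx0 ((hE.extQnorm_eq_zero_iff hx).1 h)

lemma extQnorm_smul (hE : E.IsQuasiBanach) (a : 𝕜) {x : ℕ → 𝕜} (hx : x ∈ E.carrier) :
    E.extQnorm (a • x) = ‖a‖ * E.extQnorm x := by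
  rw [E.extQnorm_of_mem (E.carrier.smul_mem a hx), E.extQnorm_of_mem hx, ← hE.smul]
  rfl

lemma extQnorm_sub_comm (hE : E.IsQuasiBanach) {x y : ℕ → 𝕜} (hx : x ∈ E.carrier)
    (hy : y ∈ E.carrier) : E.extQnorm (x - y) = E.extQnorm (y - x) := by
  simpa using hE.extQnorm_smul (-1) (E.carrier.sub_mem hy hx)

lemma exists_isConcavityModulus (hE : E.IsQuasiBanach) : ∃ K, E.IsConcavityModulus K := by
  obtain ⟨C, hC⟩ := hE.add_le
  refine ⟨max C 1, le_max_right _ _, fun x hx y hy => ?_⟩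
  have hadd : E.extQnorm (x + y) ≤ C * (E.extQnorm x + E.extQnorm y) := by
    rw [E.extQnorm_of_mem hx, E.extQnorm_of_mem hy, E.extQnorm_of_mem (E.carrier.add_mem hx hy)]
    exact hC ⟨x, hx⟩ ⟨y, hy⟩
  exact hadd.trans (mul_le_mul_of_nonneg_right (le_max_left _ _)
    (add_nonneg (hE.extQnorm_nonneg _) (hE.extQnorm_nonneg _)))

lemma mem_of_le (hE : E.IsQuasiBanach) {x y : ℕ → 𝕜} (hy : y ∈ E.carrier)
    (h : ∀ k, ‖x k‖ ≤ ‖y k‖) : x ∈ E.carrier :=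
  (hE.solid ⟨y, hy⟩ x h).1

lemma extQnorm_le_of_le (hE : E.IsQuasiBanach) {x y : ℕ → 𝕜} (hy : y ∈ E.carrier)
    (h : ∀ k, ‖x k‖ ≤ ‖y k‖) : E.extQnorm x ≤ E.extQnorm y := by
  obtain ⟨hx, hle⟩ := hE.solid ⟨y, hy⟩ x h
  rwa [E.extQnorm_of_mem hx, E.extQnorm_of_mem hy]

lemma single_mem_of_apply_ne_zero (hE : E.IsQuasiBanach) {x : ℕ → 𝕜} (hx : x ∈ E.carrier)
    {k : ℕ} (hxk : x k ≠ 0) (a : 𝕜) : Pi.single k a ∈ E.carrier := by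
  refine hE.mem_of_le (E.carrier.smul_mem (a / x k) hx) fun i => ?_
  rcases eq_or_ne i k with rfl | hi
  · simp [hxk]
  · rw [Pi.single_eq_of_ne hi, norm_zero]
    exact norm_nonneg _

lemma exists_norm_apply_le (hE : E.IsQuasiBanach) (k : ℕ) :
    ∃ C : ℝ, ∀ x ∈ E.carrier, ‖x k‖ ≤ C * E.extQnorm x := by
  by_cases hzero : ∀ x ∈ E.carrier, x k = 0
  · exact ⟨0, fun x hx => by simp [hzero x hx]⟩
  push Not at hzero
  obtain ⟨z, hz, hzk⟩ := hzero
  have he : (Pi.single k 1 : ℕ → 𝕜) ∈ E.carrier := hE.single_mem_of_apply_ne_zero hz hzk 1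
  have hpos : 0 < E.extQnorm (Pi.single k 1) := hE.extQnorm_pos he (by simp)
  refine ⟨(E.extQnorm (Pi.single k 1))⁻¹, fun x hx => ?_⟩
  rw [inv_mul_eq_div, le_div_iff₀ hpos, ← hE.extQnorm_smul _ he]
  refine hE.extQnorm_le_of_le hx fun i => ?_
  rcases eq_or_ne i k with rfl | hi
  · simp
  · simp [hi]

lemma exists_tendsto_of_cauchy (hE : E.IsQuasiBanach) {s : ℕ → ℕ → 𝕜} (hs : ∀ N, s N ∈ E.carrier)
    {b : ℕ → ℝ} (hb : Tendsto b atTop (𝓝 0))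
    (hsb : ∀ N M, N ≤ M → E.extQnorm (s M - s N) ≤ b N) :
    ∃ y ∈ E.carrier, Tendsto (fun N => E.extQnorm (s N - y)) atTop (𝓝 0) := by
  obtain ⟨y, hy⟩ := hE.complete (fun N => ⟨s N, hs N⟩) fun ε hε => by
    obtain ⟨N, hN⟩ := eventually_atTop.1 (hb.eventually (gt_mem_nhds hε))
    refine ⟨N, fun m hm n hn => ?_⟩
    change E.qnorm ⟨s m - s n, E.carrier.sub_mem (hs m) (hs n)⟩ < ε
    rw [← E.extQnorm_of_mem]
    rcases le_total n m with h | h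
    · exact (hsb n m h).trans_lt (hN n hn)
    · rw [hE.extQnorm_sub_comm (hs m) (hs n)]
      exact (hsb m n h).trans_lt (hN m hm)
  exact ⟨y, y.2, hy.congr fun N => (E.extQnorm_of_mem (E.carrier.sub_mem (hs N) y.2)).symm⟩

lemma tendsto_apply (hE : E.IsQuasiBanach) {s : ℕ → ℕ → 𝕜} (hs : ∀ N, s N ∈ E.carrier)
    {y : ℕ → 𝕜} (hy : y ∈ E.carrier) (hlim : Tendsto (fun N => E.extQnorm (s N - y)) atTop (𝓝 0))
    (k : ℕ) : Tendsto (fun N => s N k) atTop (𝓝 (y k)) := by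
  obtain ⟨C, hC⟩ := hE.exists_norm_apply_le k
  rw [tendsto_iff_norm_sub_tendsto_zero]
  exact squeeze_zero (fun _ => norm_nonneg _) (fun N => hC _ (E.carrier.sub_mem (hs N) hy))
    (by simpa using hlim.const_mul C)

lemma extQnorm_le_of_tendsto (hE : E.IsQuasiBanach) {K : ℝ} (hK : E.IsConcavityModulus K) {A : ℝ}
    {s : ℕ → ℕ → 𝕜} (hs : ∀ N, s N ∈ E.carrier) (hsA : ∀ N, E.extQnorm (s N) ≤ A)
    {y : ℕ → 𝕜} (hy : y ∈ E.carrier)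
    (hlim : Tendsto (fun N => E.extQnorm (s N - y)) atTop (𝓝 0)) : E.extQnorm y ≤ K * A := by
  have hK0 := zero_le_one.trans hK.one_le
  have hle (N : ℕ) : E.extQnorm y ≤ K * (E.extQnorm (s N - y) + A) :=
    calc E.extQnorm y = E.extQnorm (y - s N + s N) := by rw [sub_add_cancel]
      _ ≤ K * (E.extQnorm (y - s N) + E.extQnorm (s N)) :=
          hK.add_le _ (E.carrier.sub_mem hy (hs N)) _ (hs N)
      _ ≤ K * (E.extQnorm (s N - y) + A) := by
          rw [hE.extQnorm_sub_comm hy (hs N)]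
          gcongr
          exact hsA N
  exact ge_of_tendsto' (by simpa using (hlim.add_const A).const_mul K) hle

lemma extQnorm_sum_Ico_le (hE : E.IsQuasiBanach) {K : ℝ} (hK : E.IsConcavityModulus K) {A : ℝ}
    {a : ℕ → ℕ → 𝕜} (ha : ∀ n, a n ∈ E.carrier)
    (haA : ∀ n, E.extQnorm (a n) ≤ A * ((2 * K) ^ (n + 1))⁻¹) {N M : ℕ} (hNM : N ≤ M) :
    E.extQnorm (∑ n ∈ Finset.Ico N M, a n) ≤ A * ((2 * K) ^ N)⁻¹ := by
  have hK0 : 0 < K := zero_lt_one.trans_le hK.one_le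
  induction hNM using Nat.decreasingInduction with
  | self =>
    have hA : 0 ≤ A := nonneg_of_mul_nonneg_left ((hE.extQnorm_nonneg _).trans (haA 0))
      (by positivity)
    simp only [Finset.Ico_self, Finset.sum_empty, hE.extQnorm_zero]
    positivity
  | of_succ N hN ih =>
    rw [Finset.sum_eq_sum_Ico_succ_bot hN]
    calc E.extQnorm (a N + ∑ n ∈ Finset.Ico (N + 1) M, a n)
        ≤ K * (E.extQnorm (a N) + E.extQnorm (∑ n ∈ Finset.Ico (N + 1) M, a n)) :=
          hK.add_le _ (ha N) _ (E.carrier.sum_mem fun n _ => ha n)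
      _ ≤ K * (A * ((2 * K) ^ (N + 1))⁻¹ + A * ((2 * K) ^ (N + 1))⁻¹) := by
          gcongr
          exact haA N
      _ = A * ((2 * K) ^ N)⁻¹ := by
          rw [pow_succ]
          field_simp
          ring

lemma exists_majorant (hE : E.IsQuasiBanach) {K : ℝ} (hK : E.IsConcavityModulus K) {A : ℝ}
    {x : ℕ → ℕ → 𝕜} (hx : ∀ n, x n ∈ E.carrier)
    (hxA : ∀ n, E.extQnorm (x n) ≤ A * ((2 * K) ^ (n + 1))⁻¹) :
    ∃ y ∈ E.carrier, E.extQnorm y ≤ K * A ∧ ∀ n k, ‖x n k‖ ≤ ‖y k‖ := by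
  let a (n k : ℕ) : 𝕜 := (‖x n k‖ : ℝ)
  have hax (n k : ℕ) : ‖a n k‖ ≤ ‖x n k‖ := by simp [a]
  have ha (n : ℕ) : a n ∈ E.carrier := hE.mem_of_le (hx n) (hax n)
  have haA (n : ℕ) := (hE.extQnorm_le_of_le (hx n) (hax n)).trans (hxA n)
  let s (N : ℕ) : ℕ → 𝕜 := ∑ n ∈ Finset.range N, a n
  have hs (N : ℕ) : s N ∈ E.carrier := E.carrier.sum_mem fun n _ => ha n
  have hsub (N M : ℕ) (hNM : N ≤ M) : E.extQnorm (s M - s N) ≤ A * ((2 * K) ^ N)⁻¹ := by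
    rw [← Finset.sum_Ico_eq_sub _ hNM]
    exact hE.extQnorm_sum_Ico_le hK ha haA hNM
  have hgeom : Tendsto (fun N => A * ((2 * K) ^ N)⁻¹) atTop (𝓝 0) := by
    have hK1 : 1 < 2 * K := by linarith [hK.one_le]
    simpa using (tendsto_inv_atTop_zero.comp (tendsto_pow_atTop_atTop_of_one_lt hK1)).const_mul A
  obtain ⟨y, hy, hlim⟩ := hE.exists_tendsto_of_cauchy hs hgeom hsub
  refine ⟨y, hy, hE.extQnorm_le_of_tendsto hK hs (fun N => ?_) hy hlim, fun n k => ?_⟩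
  · simpa [s] using hsub 0 N N.zero_le
  · refine ge_of_tendsto (hE.tendsto_apply hs hy hlim k).norm ?_
    filter_upwards [eventually_gt_atTop n] with N hN
    have hsk : s N k = ((∑ n ∈ Finset.range N, ‖x n k‖ : ℝ) : 𝕜) := by
      simp [s, a, Finset.sum_apply]
    rw [hsk, RCLike.norm_ofReal, abs_of_nonneg (Finset.sum_nonneg fun _ _ => norm_nonneg _)]
    exact Finset.single_le_sum (f := fun n => ‖x n k‖) (fun _ _ => norm_nonneg _)
      (Finset.mem_range.2 hN)

lemma exists_bound_of_homogeneous (hE : E.IsQuasiBanach) {R : (ℕ → 𝕜) → (ℕ → 𝕜) → Prop}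
    (hmem : ∀ u ∈ E.carrier, ∀ v, R u v → v ∈ E.carrier)
    (hsmul : ∀ (a : 𝕜) u v, R u v → R (a • u) (a • v)) (hzero : ∀ v, R 0 v → v = 0)
    {ε : ℕ → ℝ} (hε : ∀ n, 0 < ε n)
    (hbdd : ∀ u v : ℕ → ℕ → 𝕜, (∀ n, u n ∈ E.carrier) → (∀ n, E.extQnorm (u n) ≤ ε n) →
      (∀ n, R (u n) (v n)) → ∃ B, ∀ n, E.extQnorm (v n) ≤ B) :
    ∃ C, 0 < C ∧ ∀ u ∈ E.carrier, ∀ v, R u v → E.extQnorm v ≤ C * E.extQnorm u := by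
  by_contra! hunbounded
  have hscaled (n : ℕ) : ∃ u ∈ E.carrier, ∃ v, E.extQnorm u ≤ ε n ∧ R u v ∧
      n < E.extQnorm v := by
    have := hε n
    obtain ⟨u, hu, v, huv, hlt⟩ := hunbounded ((n + 1) / ε n) (by positivity)
    have hu0 : u ≠ 0 := by
      rintro rfl
      simp [hzero v huv, hE.extQnorm_zero] at hlt
    have hpos := hE.extQnorm_pos hu hu0
    have hnorm : ‖((ε n / E.extQnorm u : ℝ) : 𝕜)‖ = ε n / E.extQnorm u := by
      rw [RCLike.norm_ofReal, abs_of_pos (by positivity)]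
    refine ⟨_, E.carrier.smul_mem ((ε n / E.extQnorm u : ℝ) : 𝕜) hu, _, ?_, hsmul _ _ _ huv, ?_⟩
    · rw [hE.extQnorm_smul _ hu, hnorm, div_mul_cancel₀ _ hpos.ne']
    · rw [hE.extQnorm_smul _ (hmem u hu v huv), hnorm, div_mul_eq_mul_div, lt_div_iff₀ hpos]
      rw [div_mul_eq_mul_div, div_lt_iff₀ this] at hlt
      linarith
  choose u hu v hle huv hlt using hscaled
  obtain ⟨B, hB⟩ := hbdd u v hu hle huv
  obtain ⟨n, hn⟩ := exists_nat_gt B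
  linarith [hlt n, hB n]

lemma exists_bound_of_monotone (hE : E.IsQuasiBanach) {Φ : (ℕ → 𝕜) → ℕ → 𝕜}
    (hsmul : ∀ (a : 𝕜) x, Φ (a • x) = a • Φ x)
    (hmono : ∀ x y, (∀ k, ‖x k‖ ≤ ‖y k‖) → ∀ k, ‖Φ x k‖ ≤ ‖Φ y k‖)
    (hmem : ∀ x ∈ E.carrier, Φ x ∈ E.carrier) :
    ∃ C, 0 < C ∧ ∀ x ∈ E.carrier, E.extQnorm (Φ x) ≤ C * E.extQnorm x := by
  obtain ⟨K, hK⟩ := hE.exists_isConcavityModulus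
  have hK0 : 0 < K := zero_lt_one.trans_le hK.one_le
  obtain ⟨C, hC, hbound⟩ := hE.exists_bound_of_homogeneous (R := fun x y => y = Φ x)
    (ε := fun n => 1 * ((2 * K) ^ (n + 1))⁻¹) (by rintro x hx _ rfl; exact hmem x hx)
    (by rintro a x _ rfl; exact (hsmul a x).symm)
    (by rintro _ rfl; simpa using hsmul 0 0) (fun n => by positivity) fun x y hx hxε hxy => by
      obtain ⟨w, hw, -, hxw⟩ := hE.exists_majorant hK hx hxε
      refine ⟨E.extQnorm (Φ w), fun n => ?_⟩
      rw [hxy n]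
      exact hE.extQnorm_le_of_le (hmem w hw) (hmono (x n) w (hxw n))
  exact ⟨C, hC, fun x hx => hbound x hx _ rfl⟩

end NormedSeqSpace.IsQuasiBanach

end QuasiBanach

/-! ### Bounded operators on `ℓ^r` -/

section Ellp

variable {𝕜 : Type*} [RCLike 𝕜]

lemma mem_ellp_iff {r : ℝ} (hr : 0 < r) (x : ℕ → 𝕜) :
    x ∈ (ellp 𝕜 (ENNReal.ofReal r)).carrier ↔ ∑' k, ‖x k‖ₑ ^ r ≠ ∞ := by
  have hr' : (ENNReal.ofReal r).toReal = r := ENNReal.toReal_ofReal hr.le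
  change Memℓp x _ ↔ _
  simp_rw [memℓp_gen_iff (hr'.symm ▸ hr), hr', ← enorm_norm (x _),
    ← Real.enorm_rpow_of_nonneg (norm_nonneg (x _)) hr.le]
  rw [← summable_norm_iff]
  exact tsum_enorm_ne_top_iff_summable_norm.symm

lemma ellp_mono {p q : ℝ≥0∞} (h : p ≤ q) : (ellp 𝕜 p).carrier ≤ (ellp 𝕜 q).carrier :=
  fun _ hx => Memℓp.of_exponent_ge hx h

lemma qnorm_ellp_nonneg {p : ℝ≥0∞} (x : (ellp 𝕜 p).carrier) : 0 ≤ (ellp 𝕜 p).qnorm x :=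
  lp.norm_nonneg' (⟨x.1, x.2⟩ : lp (fun _ : ℕ => 𝕜) p)

lemma ofReal_qnorm_ellp_rpow {r : ℝ} (hr : 0 < r) (x : (ellp 𝕜 (ENNReal.ofReal r)).carrier) :
    ENNReal.ofReal ((ellp 𝕜 (ENNReal.ofReal r)).qnorm x) ^ r = ∑' k, ‖(x : ℕ → 𝕜) k‖ₑ ^ r := by
  have hr' : (ENNReal.ofReal r).toReal = r := ENNReal.toReal_ofReal hr.le
  have hsum := (memℓp_gen_iff (hr'.symm ▸ hr)).1 x.2
  have hnorm := lp.norm_rpow_eq_tsum (p := ENNReal.ofReal r) (hr'.symm ▸ hr)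
    (⟨x.1, x.2⟩ : lp (fun _ : ℕ => 𝕜) (ENNReal.ofReal r))
  rw [hr'] at hnorm hsum
  rw [ENNReal.ofReal_rpow_of_nonneg (qnorm_ellp_nonneg x) hr.le]
  refine (congrArg ENNReal.ofReal hnorm).trans ?_
  rw [ENNReal.ofReal_tsum_of_nonneg (fun _ => by positivity) hsum]
  exact tsum_congr fun k => by
    rw [← ENNReal.ofReal_rpow_of_nonneg (norm_nonneg _) hr.le, ofReal_norm]

/-- `T` is bounded on `ℓ^r`, with `C` a bound for the `r`-th power of its norm. -/
def EllpBoundedBy {V : Submodule 𝕜 (ℕ → 𝕜)} (T : V →ₗ[𝕜] V) (r : ℝ) (C : ℝ≥0) : Prop :=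
  ∀ x : V, ∑' k, ‖(x : ℕ → 𝕜) k‖ₑ ^ r ≠ ∞ →
    ∑' k, ‖(T x : ℕ → 𝕜) k‖ₑ ^ r ≤ C * ∑' k, ‖(x : ℕ → 𝕜) k‖ₑ ^ r

lemma restrictsBounded_ellp_iff {r : ℝ} (hr : 0 < r) {V : Submodule 𝕜 (ℕ → 𝕜)} (T : V →ₗ[𝕜] V) :
    RestrictsBounded T (ellp 𝕜 (ENNReal.ofReal r)) ↔ ∃ C, EllpBoundedBy T r C := by
  constructor
  · rintro ⟨C, hC⟩
    refine ⟨C.toNNReal ^ r, fun x hx => ?_⟩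
    obtain ⟨hT, hle⟩ := hC x ((mem_ellp_iff hr _).2 hx)
    rw [← ofReal_qnorm_ellp_rpow hr ⟨_, hT⟩, ENNReal.coe_rpow_of_nonneg _ hr.le,
      ← ofReal_qnorm_ellp_rpow hr ⟨_, (mem_ellp_iff hr _).2 hx⟩,
      ← ENNReal.mul_rpow_of_nonneg _ _ hr.le]
    gcongr
    exact (ENNReal.ofReal_le_ofReal hle).trans_eq (ENNReal.ofReal_mul' (qnorm_ellp_nonneg _))
  · rintro ⟨C, hC⟩
    refine ⟨(C ^ r⁻¹ : ℝ≥0), fun x hx => ?_⟩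
    have hx' := (mem_ellp_iff hr _).1 hx
    have hle := hC x hx'
    have hT := (mem_ellp_iff hr _).2 (ne_top_of_le_ne_top (by finiteness) hle)
    refine ⟨hT, ?_⟩
    rw [← ofReal_qnorm_ellp_rpow hr ⟨_, hT⟩, ← ofReal_qnorm_ellp_rpow hr ⟨_, hx⟩,
      ← ENNReal.rpow_inv_rpow hr.ne' (C : ℝ≥0∞), ← ENNReal.mul_rpow_of_nonneg _ _ hr.le,
      ENNReal.rpow_le_rpow_iff hr, ← ENNReal.coe_rpow_of_nonneg _ (inv_nonneg.2 hr.le),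
      ← ENNReal.ofReal_coe_nnreal, ← ENNReal.ofReal_mul NNReal.zero_le_coe] at hle
    exact (ENNReal.ofReal_le_ofReal_iff
      (mul_nonneg NNReal.zero_le_coe (qnorm_ellp_nonneg _))).1 hle

end Ellp

/-! ### Nonnegative matrices -/

section Matrix

variable {𝕜 : Type*} [RCLike 𝕜] {ι κ : Type*}

/-- The matrix `M` acts boundedly on `ℓ^r`. -/
def MatrixBounded (r : ℝ) (M : κ → ι → ℝ≥0) : Prop :=
  ∃ C : ℝ≥0, ∀ x : ι → ℝ≥0∞, ∑' j, (∑' k, M j k * x k) ^ r ≤ C * ∑' k, x k ^ r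

/-- The action of a nonnegative matrix on scalar families. The value at `j` is meaningful only if
the series `∑ k, M j k * x k` converges. -/
noncomputable def matrixTransform (M : κ → ι → ℝ≥0) (x : ι → 𝕜) (j : κ) : 𝕜 :=
  ∑' k, ((M j k : ℝ) : 𝕜) * x k

lemma enorm_coe_mul (a : ℝ≥0) (z : 𝕜) : ‖((a : ℝ) : 𝕜) * z‖ₑ = a * ‖z‖ₑ := by
  rw [enorm_mul]
  congr 1
  rw [← ofReal_norm, RCLike.norm_of_nonneg a.coe_nonneg, ENNReal.ofReal_coe_nnreal]

lemma enorm_matrixTransform_le (M : κ → ι → ℝ≥0) (x : ι → 𝕜) (j : κ) :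
    ‖matrixTransform M x j‖ₑ ≤ ∑' k, M j k * ‖x k‖ₑ := by
  simp only [← enorm_coe_mul (𝕜 := 𝕜)]
  exact enorm_tsum_le_tsum_enorm

lemma enorm_matrixTransform_norm {M : κ → ι → ℝ≥0} {x : ι → 𝕜} {j : κ}
    (h : ∑' k, M j k * ‖x k‖ₑ ≠ ∞) :
    ‖matrixTransform M (fun k => ((‖x k‖ : ℝ) : 𝕜)) j‖ₑ = ∑' k, M j k * ‖x k‖ₑ := by
  have hterm (k : ι) : ((M j k : ℝ) : 𝕜) * ((‖x k‖ : ℝ) : 𝕜) = ((M j k * ‖x k‖₊ : ℝ≥0) : ℝ) := by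
    simp
  rw [matrixTransform, tsum_congr hterm, ← RCLike.ofReal_tsum, ← NNReal.coe_tsum, ← ofReal_norm,
    RCLike.norm_of_nonneg NNReal.zero_le_coe, ENNReal.ofReal_coe_nnreal, ENNReal.coe_tsum]
  · simp [enorm]
  · refine ENNReal.tsum_coe_ne_top_iff_summable.1 ?_
    simpa [enorm] using h

/-- The endomorphism of a space of sequences given by a nonnegative matrix. -/
noncomputable def matrixOperator (M : ι → ι → ℝ≥0) (V : Submodule 𝕜 (ι → 𝕜))
    (hsum : ∀ x ∈ V, ∀ j, ∑' k, M j k * ‖x k‖ₑ ≠ ∞)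
    (hmem : ∀ x ∈ V, matrixTransform M x ∈ V) : V →ₗ[𝕜] V :=
  have summable (x : V) (j : ι) : Summable fun k => ((M j k : ℝ) : 𝕜) * (x : ι → 𝕜) k := by
    refine (tsum_enorm_ne_top_iff_summable_norm.1 ?_).of_norm
    simpa only [enorm_coe_mul] using hsum x x.2 j
  { toFun := fun x => ⟨matrixTransform M x, hmem x x.2⟩
    map_add' := fun x y => by
      ext j
      simp only [matrixTransform, Submodule.coe_add, Pi.add_apply, mul_add]
      exact (summable x j).tsum_add (summable y j)
    map_smul' := fun c x => by
      ext j
      simp only [matrixTransform, Submodule.coe_smul, Pi.smul_apply, smul_eq_mul, RingHom.id_apply,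
        ← tsum_mul_left]
      exact tsum_congr fun k => mul_left_comm _ _ _ }

lemma MatrixBounded.exists_tsum_matrixTransform_le {r : ℝ} (hr : 0 ≤ r) {M : κ → ι → ℝ≥0}
    (hM : MatrixBounded r M) :
    ∃ C : ℝ≥0, ∀ x : ι → 𝕜, ∑' j, ‖matrixTransform M x j‖ₑ ^ r ≤ C * ∑' k, ‖x k‖ₑ ^ r := by
  obtain ⟨C, hC⟩ := hM
  refine ⟨C, fun x => (ENNReal.tsum_le_tsum fun j => ?_).trans (hC fun k => ‖x k‖ₑ)⟩
  exact ENNReal.rpow_le_rpow (enorm_matrixTransform_le M x j) hr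

lemma MatrixBounded.tsum_mul_ne_top {r : ℝ} (hr : 0 < r) {M : κ → ι → ℝ≥0}
    (hM : MatrixBounded r M) {x : ι → ℝ≥0∞} (hx : ∑' k, x k ^ r ≠ ∞) (j : κ) :
    ∑' k, M j k * x k ≠ ∞ := fun htop => by
  obtain ⟨C, hC⟩ := hM
  refine ENNReal.ne_top_of_tsum_ne_top (ne_top_of_le_ne_top (by finiteness) (hC x)) j ?_
  rw [htop, ENNReal.top_rpow_of_pos hr]

lemma matrixBounded_comp [DecidableEq ι] (r : ℝ) {τ : κ → ι} (hτ : τ.Injective) :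
    MatrixBounded r fun j k => if k = τ j then 1 else 0 := by
  refine ⟨1, fun x => ?_⟩
  rw [ENNReal.coe_one, one_mul]
  refine (tsum_congr fun j => ?_).trans_le (ENNReal.tsum_comp_le_tsum_of_injective hτ (x · ^ r))
  rw [tsum_eq_single (τ j) fun k hk => by simp [hk]]
  simp

lemma matrixBounded_extend [DecidableEq κ] {r : ℝ} (hr : 0 < r) {τ : ι → κ} (hτ : τ.Injective) :
    MatrixBounded r fun j k => if j = τ k then 1 else 0 := by
  refine ⟨1, fun x => ?_⟩
  rw [ENNReal.coe_one, one_mul, ← hτ.tsum_eq]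
  · refine (tsum_congr fun j => ?_).le
    rw [tsum_eq_single j fun k hk => by simp [hτ.eq_iff, hk.symm]]
    simp
  · rw [Function.support_subset_iff']
    intro j hj
    have hne (k : ι) : j ≠ τ k := fun h => hj ⟨k, h.symm⟩
    simp [hne, hr]

lemma rpow_tsum_mul_le_tsum_mul_rpow {r : ℝ} (hr : 1 ≤ r) {w : ι → ℝ≥0∞} (hw : ∑' k, w k ≤ 1)
    (z : ι → ℝ≥0∞) : (∑' k, w k * z k) ^ r ≤ ∑' k, w k * z k ^ r := by
  rw [← ENNReal.le_rpow_inv_iff (by linarith), ENNReal.tsum_eq_iSup_sum]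
  refine iSup_le fun s => (ENNReal.inner_le_weight_mul_Lp_of_nonneg s hr w z).trans ?_
  have hexp : 0 ≤ 1 - r⁻¹ := sub_nonneg.2 (inv_le_one_of_one_le₀ hr)
  refine (mul_le_of_le_one_left zero_le
    (ENNReal.rpow_le_one ((ENNReal.sum_le_tsum s).trans hw) hexp)).trans ?_
  gcongr
  exact ENNReal.sum_le_tsum s

lemma rpow_tsum_le_tsum_rpow {r : ℝ} (hr : 0 < r) (hr1 : r ≤ 1) (z : ι → ℝ≥0∞) :
    (∑' k, z k) ^ r ≤ ∑' k, z k ^ r := by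
  rw [← ENNReal.le_rpow_inv_iff hr, ENNReal.tsum_eq_iSup_sum]
  refine iSup_le fun s => (ENNReal.le_rpow_inv_iff hr).2 (le_trans ?_ (ENNReal.sum_le_tsum s))
  exact Finset.le_sum_of_subadditive (fun x : ℝ≥0∞ => x ^ r) (by simp [hr])
    (fun a b => ENNReal.rpow_add_le_add_rpow a b hr.le hr1) s z

lemma matrixBounded_of_tsum_le {r : ℝ} {M : κ → ι → ℝ≥0} {N : κ → ι → ℝ≥0∞} {A : ℝ≥0}
    (hrow : ∀ (x : ι → ℝ≥0∞) j, (∑' k, M j k * x k) ^ r ≤ ∑' k, N j k * x k ^ r)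
    (hcol : ∀ k, ∑' j, N j k ≤ A) : MatrixBounded r M := by
  refine ⟨A, fun x => ?_⟩
  calc ∑' j, (∑' k, M j k * x k) ^ r ≤ ∑' j, ∑' k, N j k * x k ^ r :=
        ENNReal.tsum_le_tsum fun j => hrow x j
    _ = ∑' k, (∑' j, N j k) * x k ^ r := by
        rw [ENNReal.tsum_comm]
        exact tsum_congr fun k => ENNReal.tsum_mul_right
    _ ≤ ∑' k, A * x k ^ r := ENNReal.tsum_le_tsum fun k => mul_le_mul_left (hcol k) _
    _ = A * ∑' k, x k ^ r := ENNReal.tsum_mul_left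

lemma matrixBounded_of_schur_test {r : ℝ} (hr : 1 ≤ r) {w c : κ → ι → ℝ≥0} {A : ℝ≥0}
    (hrow : ∀ j, ∑' k, (w j k : ℝ≥0∞) ≤ 1)
    (hcol : ∀ k, ∑' j, (w j k * (c j k : ℝ≥0∞) ^ r) ≤ A) :
    MatrixBounded r fun j k => w j k * c j k := by
  refine matrixBounded_of_tsum_le (fun x j => ?_) hcol
  have := rpow_tsum_mul_le_tsum_mul_rpow hr (hrow j) fun k => c j k * x k
  simpa only [ENNReal.mul_rpow_of_nonneg _ _ (zero_le_one.trans hr), ENNReal.coe_mul,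
    mul_assoc] using this

lemma matrixBounded_of_le_one {r : ℝ} (hr : 0 < r) (hr1 : r ≤ 1) {M : κ → ι → ℝ≥0} {d : ℕ}
    (hM : ∀ j k, M j k ≤ 1) {S : ι → Finset κ} (hS : ∀ k, (S k).card ≤ d)
    (hMS : ∀ j k, j ∉ S k → M j k = 0) : MatrixBounded r M := by
  refine matrixBounded_of_tsum_le (N := fun j k => (M j k : ℝ≥0∞) ^ r) (A := d) (fun x j => ?_)
    fun k => ?_
  · simpa only [ENNReal.mul_rpow_of_nonneg _ _ hr.le] using
      rpow_tsum_le_tsum_rpow hr hr1 fun k => M j k * x k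
  · rw [tsum_eq_sum (s := S k) fun j hj => by simp [hMS j k hj, hr]]
    calc ∑ j ∈ S k, (M j k : ℝ≥0∞) ^ r ≤ (S k).card • 1 := Finset.sum_le_card_nsmul _ _ _
          fun j _ => ENNReal.rpow_le_one (ENNReal.coe_le_one_iff.2 (hM j k)) hr.le
      _ ≤ (d : ℝ≥0) := by simpa using hS k

end Matrix

section Interpolation

variable {𝕜 : Type*} [RCLike 𝕜] {E : NormedSeqSpace 𝕜} {p q : ℝ}

lemma ellp_sup_ellp (hpq : p ≤ q) :
    (ellp 𝕜 (ENNReal.ofReal p)).carrier ⊔ (ellp 𝕜 (ENNReal.ofReal q)).carrier =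
      (ellp 𝕜 (ENNReal.ofReal q)).carrier :=
  sup_eq_right.2 (ellp_mono (ENNReal.ofReal_le_ofReal hpq))

namespace IsInterpolationSpace

lemma tsum_rpow_ne_top (hp : 0 < p) (hpq : p ≤ q)
    (h : IsInterpolationSpace (ellp 𝕜 (ENNReal.ofReal p)) (ellp 𝕜 (ENNReal.ofReal q)) E)
    {u : ℕ → 𝕜} (hu : u ∈ E.carrier) : ∑' k, ‖u k‖ₑ ^ q ≠ ∞ := by
  rw [← mem_ellp_iff (hp.trans_le hpq), ← ellp_sup_ellp hpq]
  exact h.2.1 hu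

lemma mem_of_enorm_le_tsum (hE : E.IsQuasiBanach) (hp : 0 < p) (hpq : p ≤ q)
    (h : IsInterpolationSpace (ellp 𝕜 (ENNReal.ofReal p)) (ellp 𝕜 (ENNReal.ofReal q)) E)
    {M : ℕ → ℕ → ℝ≥0} (hMp : MatrixBounded p M) (hMq : MatrixBounded q M) {u v : ℕ → 𝕜}
    (hu : u ∈ E.carrier) (hv : ∀ j, ‖v j‖ₑ ≤ ∑' k, M j k * ‖u k‖ₑ) : v ∈ E.carrier := by
  have hq : 0 < q := hp.trans_le hpq
  set V := (ellp 𝕜 (ENNReal.ofReal p)).carrier ⊔ (ellp 𝕜 (ENNReal.ofReal q)).carrier with hV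
  have mem_V (x : ℕ → 𝕜) : x ∈ V ↔ ∑' k, ‖x k‖ₑ ^ q ≠ ∞ := by
    rw [hV, ellp_sup_ellp hpq, mem_ellp_iff hq]
  have hsum (x : ℕ → 𝕜) (hx : x ∈ V) (j : ℕ) : ∑' k, M j k * ‖x k‖ₑ ≠ ∞ :=
    hMq.tsum_mul_ne_top hq ((mem_V x).1 hx) j
  have hmem (x : ℕ → 𝕜) (hx : x ∈ V) : matrixTransform M x ∈ V := by
    obtain ⟨C, hC⟩ := hMq.exists_tsum_matrixTransform_le (𝕜 := 𝕜) hq.le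
    have := (mem_V x).1 hx
    exact (mem_V _).2 (ne_top_of_le_ne_top (by finiteness) (hC x))
  have hbounded {r : ℝ} (hr : 0 < r) (hMr : MatrixBounded r M) :
      RestrictsBounded (matrixOperator M V hsum hmem) (ellp 𝕜 (ENNReal.ofReal r)) := by
    obtain ⟨C, hC⟩ := hMr.exists_tsum_matrixTransform_le (𝕜 := 𝕜) hr.le
    exact (restrictsBounded_ellp_iff hr _).2 ⟨C, fun x _ => hC x⟩
  obtain ⟨C, hC⟩ := h.2.2 _ (hbounded hp hMp) (hbounded hq hMq)
  have habs : (fun k => ((‖u k‖ : ℝ) : 𝕜)) ∈ E.carrier := hE.mem_of_le hu fun k => by simp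
  obtain ⟨hTu, -⟩ := hC ⟨_, h.2.1 habs⟩ habs
  refine hE.mem_of_le hTu fun j => enorm_le_iff_norm_le.1 ((hv j).trans_eq ?_)
  exact (enorm_matrixTransform_norm (hsum u (h.2.1 hu) j)).symm

lemma comp_mem (hE : E.IsQuasiBanach) (hp : 0 < p) (hpq : p ≤ q)
    (h : IsInterpolationSpace (ellp 𝕜 (ENNReal.ofReal p)) (ellp 𝕜 (ENNReal.ofReal q)) E)
    {u : ℕ → 𝕜} (hu : u ∈ E.carrier) {τ : ℕ → ℕ} (hτ : τ.Injective) : u ∘ τ ∈ E.carrier :=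
  h.mem_of_enorm_le_tsum hE hp hpq (matrixBounded_comp p hτ) (matrixBounded_comp q hτ) hu
    fun j => by
      rw [tsum_eq_single (τ j) fun k hk => by simp [hk]]
      simp

lemma mem_of_comp_mem (hE : E.IsQuasiBanach) (hp : 0 < p) (hpq : p ≤ q)
    (h : IsInterpolationSpace (ellp 𝕜 (ENNReal.ofReal p)) (ellp 𝕜 (ENNReal.ofReal q)) E)
    {v : ℕ → 𝕜} {τ : ℕ → ℕ} (hτ : τ.Injective) (hv : v ∘ τ ∈ E.carrier)
    (h0 : ∀ k ∉ Set.range τ, v k = 0) : v ∈ E.carrier := by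
  refine h.mem_of_enorm_le_tsum hE hp hpq (matrixBounded_extend hp hτ)
    (matrixBounded_extend (hp.trans_le hpq) hτ) hv fun j => ?_
  by_cases hj : j ∈ Set.range τ
  · obtain ⟨k, rfl⟩ := hj
    rw [tsum_eq_single k fun i hi => by simp [hτ.eq_iff, hi.symm]]
    simp
  · simp [h0 j hj]

end IsInterpolationSpace

end Interpolation

/-! ### The monotone coupling -/

section Coupling

/-- `w` moves the mass `β` onto a part of the mass `α`, never to the left, and in a monotone way:
a mass `β j` lying strictly between two others that are sent to the same `k` is sent to `k`
entirely, together with parts of the other two. -/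
structure IsMonotoneCoupling (w : ℕ → ℕ → ℝ≥0) (α β : ℕ → ℝ≥0) : Prop where
  tsum_row : ∀ j, ∑' k, (w j k : ℝ≥0∞) = β j
  tsum_col_le : ∀ k, ∑' j, (w j k : ℝ≥0∞) ≤ α k
  le_of_ne_zero : ∀ ⦃j k⦄, w j k ≠ 0 → j ≤ k
  lt_of_lt_of_lt : ∀ ⦃i j l k⦄, i < j → j < l → w i k ≠ 0 → w l k ≠ 0 → β j < α k

/-- The length of the intersection of the intervals `[B (j + 1), B j]` and `[A (k + 1), A k]`;
the truncated subtraction makes it `0` when they are disjoint. -/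
def overlap (A B : ℕ → ℝ≥0) (j k : ℕ) : ℝ≥0 :=
  min (B j) (A k) - max (B (j + 1)) (A (k + 1))

variable {A B : ℕ → ℝ≥0}

lemma overlap_comm (A B : ℕ → ℝ≥0) (j k : ℕ) : overlap A B j k = overlap B A k j := by
  rw [overlap, overlap, min_comm, max_comm]

lemma overlap_add (hA : Antitone A) (hB : Antitone B) (j k : ℕ) :
    overlap A B j k + (min (B j) (A (k + 1)) - B (j + 1)) = min (B j) (A k) - B (j + 1) := by
  have hAk := hA k.le_succ
  have hBj := hB j.le_succ
  simp only [Nat.succ_eq_add_one, ← NNReal.coe_le_coe] at hAk hBj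
  rw [overlap, ← NNReal.coe_inj]
  push_cast [NNReal.coe_sub_def]
  simp only [max_def, min_def]
  split_ifs <;> linarith

lemma sum_range_overlap_add (hA : Antitone A) (hB : Antitone B) (j n : ℕ) :
    ∑ k ∈ Finset.range n, overlap A B j k + (min (B j) (A n) - B (j + 1)) =
      min (B j) (A 0) - B (j + 1) := by
  induction n with
  | zero => simp
  | succ n ih => rw [Finset.sum_range_succ, add_assoc, overlap_add hA hB, ih]

lemma hasSum_overlap (hA : Antitone A) (hB : Antitone B) (hA0 : Tendsto A atTop (𝓝 0))
    (hBA : B ≤ A) (j : ℕ) : HasSum (overlap A B j) (B j - B (j + 1)) := by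
  rw [NNReal.hasSum_iff_tendsto_nat]
  have hsum : ∀ n, ∑ k ∈ Finset.range n, overlap A B j k =
      B j - B (j + 1) - (min (B j) (A n) - B (j + 1)) := fun n => by
    have h := sum_range_overlap_add hA hB j n
    rw [min_eq_left ((hB j.zero_le).trans (hBA 0))] at h
    rw [← h, add_tsub_cancel_right]
  have hlim : Tendsto (fun n => min (B j) (A n) - B (j + 1)) atTop (𝓝 0) := by
    simpa using (tendsto_const_nhds.min hA0).sub (tendsto_const_nhds (x := B (j + 1)))
  simpa only [hsum, tsub_zero] using tendsto_const_nhds.sub hlim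

lemma lt_of_overlap_ne_zero {j k : ℕ} (h : overlap A B j k ≠ 0) :
    B (j + 1) < A k ∧ A (k + 1) < B j := by
  have h := tsub_pos_iff_lt.1 (pos_iff_ne_zero.2 h)
  rw [max_lt_iff, lt_min_iff, lt_min_iff] at h
  exact ⟨h.1.2, h.2.1⟩

lemma isMonotoneCoupling_overlap (hA : Antitone A) (hB : Antitone B)
    (hA0 : Tendsto A atTop (𝓝 0)) (hBA : B ≤ A) :
    IsMonotoneCoupling (overlap A B) (fun k => A k - A (k + 1)) fun j => B j - B (j + 1) where
  tsum_row j := (ENNReal.hasSum_coe.2 (hasSum_overlap hA hB hA0 hBA j)).tsum_eq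
  tsum_col_le k := by
    refine ENNReal.tsum_le_of_sum_range_le fun n => ?_
    have hn : ∑ j ∈ Finset.range n, overlap A B j k ≤ A k - A (k + 1) := by
      simp only [overlap_comm A B]
      exact (le_self_add.trans (sum_range_overlap_add hB hA k n).le).trans
        (tsub_le_tsub_right (min_le_left _ _) _)
    exact_mod_cast hn
  le_of_ne_zero j k h := by
    by_contra! hkj
    exact ((lt_of_overlap_ne_zero h).2.trans_le (hBA j)).not_ge (hA hkj)
  lt_of_lt_of_lt i j l k hij hjl hi hl := by
    have hBj : B j < A k := (hB hij).trans_lt (lt_of_overlap_ne_zero hi).1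
    have hAk : A (k + 1) < B (j + 1) := (lt_of_overlap_ne_zero hl).2.trans_le (hB hjl)
    calc B j - B (j + 1) ≤ B j - A (k + 1) := tsub_le_tsub_left hAk.le _
      _ < A k - A (k + 1) := tsub_lt_tsub_right_of_le (hAk.le.trans (hB j.le_succ)) hBj

lemma tsum_add_eq_add_tsum_add_succ {f : ℕ → ℝ≥0} (hf : Summable f) (n : ℕ) :
    ∑' i, f (i + n) = f n + ∑' i, f (i + (n + 1)) := by
  have hfn : Summable fun i => f (i + n) := (NNReal.summable_nat_add_iff n).2 hf
  simpa [add_assoc, add_comm 1 n] using NNReal.sum_add_tsum_nat_add 1 hfn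

lemma exists_isMonotoneCoupling {α β : ℕ → ℝ≥0} (hα : Summable α) (hβ : Summable β)
    (h : ∀ n, ∑' i, β (i + n) ≤ ∑' i, α (i + n)) : ∃ w, IsMonotoneCoupling w α β := by
  have hanti : ∀ f : ℕ → ℝ≥0, Summable f → Antitone fun n => ∑' i, f (i + n) := fun f hf =>
    antitone_nat_of_succ_le fun n => by rw [tsum_add_eq_add_tsum_add_succ hf n]; exact le_add_self
  have hdiff : ∀ f : ℕ → ℝ≥0, Summable f →
      (fun n => ∑' i, f (i + n) - ∑' i, f (i + (n + 1))) = f := fun f hf => by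
    funext n
    rw [tsum_add_eq_add_tsum_add_succ hf n, add_tsub_cancel_right]
  have hw := isMonotoneCoupling_overlap (hanti α hα) (hanti β hβ)
    (NNReal.tendsto_sum_nat_add α) h
  rw [hdiff α hα, hdiff β hβ] at hw
  exact ⟨_, hw⟩

end Coupling

section Transport

variable {q : ℝ} {a b : ℕ → ℝ≥0} {w : ℕ → ℕ → ℝ≥0}

namespace IsMonotoneCoupling

lemma le_fst {α β : ℕ → ℝ≥0} (hw : IsMonotoneCoupling w α β) (j k : ℕ) : w j k ≤ α k :=
  ENNReal.coe_le_coe.1 ((ENNReal.le_tsum j).trans (hw.tsum_col_le k))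

lemma le_snd {α β : ℕ → ℝ≥0} (hw : IsMonotoneCoupling w α β) (j k : ℕ) : w j k ≤ β j :=
  ENNReal.coe_le_coe.1 ((ENNReal.le_tsum k).trans (hw.tsum_row j).le)

lemma ne_zero_fst (hq : 0 < q) (hw : IsMonotoneCoupling w (a · ^ q) (b · ^ q)) {j k : ℕ}
    (h : w j k ≠ 0) : a k ≠ 0 := fun ha =>
  h (by simpa [ha, hq.ne'] using hw.le_fst j k)

lemma ne_zero_snd (hq : 0 < q) (hw : IsMonotoneCoupling w (a · ^ q) (b · ^ q)) {j k : ℕ}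
    (h : w j k ≠ 0) : b j ≠ 0 := fun hb =>
  h (by simpa [hb, hq.ne'] using hw.le_snd j k)

lemma le_of_antitone (hq : 0 < q) (hw : IsMonotoneCoupling w (a · ^ q) (b · ^ q))
    (ha : Antitone a) (hab : ∀ j, b j ≠ 0 → a j ≤ b j) {j k : ℕ} (h : w j k ≠ 0) : a k ≤ b j :=
  (ha (hw.le_of_ne_zero h)).trans (hab j (hw.ne_zero_snd hq h))

lemma exists_finset_card_le_two (hq : 0 < q)
    (hw : IsMonotoneCoupling w (a · ^ q) (b · ^ q)) (ha : Antitone a)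
    (hab : ∀ j, b j ≠ 0 → a j ≤ b j) (k : ℕ) :
    ∃ S : Finset ℕ, S.card ≤ 2 ∧ ∀ j, j ∉ S → w j k = 0 := by
  classical
  let S := (Finset.range (k + 1)).filter fun j => w j k ≠ 0
  have hS : ∀ j, w j k ≠ 0 → j ∈ S := fun j hj =>
    Finset.mem_filter.2 ⟨Finset.mem_range.2 (Nat.lt_succ_of_le (hw.le_of_ne_zero hj)), hj⟩
  refine ⟨S, ?_, fun j hj => not_not.1 (mt (hS j) hj)⟩
  obtain hS0 | hS0 := S.eq_empty_or_nonempty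
  · simp [hS0]
  refine (Finset.card_le_card fun j hj => ?_).trans
    (Finset.card_le_two (a := S.min' hS0) (b := S.max' hS0))
  simp only [Finset.mem_insert, Finset.mem_singleton]
  by_contra! hne
  have hsupp : ∀ i ∈ S, w i k ≠ 0 := fun i hi => (Finset.mem_filter.1 hi).2
  have hlt := hw.lt_of_lt_of_lt (lt_of_le_of_ne (S.min'_le j hj) hne.1.symm)
    (lt_of_le_of_ne (S.le_max' j hj) hne.2) (hsupp _ (S.min'_mem hS0)) (hsupp _ (S.max'_mem hS0))
  exact hlt.not_ge (NNReal.rpow_le_rpow (hw.le_of_antitone hq ha hab (hsupp j hj)) hq.le)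

end IsMonotoneCoupling

/-- The matrix carrying `a` to `b` along a coupling `w` of their `q`-th powers; the two factors
are the conditional probabilities `w j k / b j ^ q` and the ratios `b j / a k`. -/
noncomputable def transportMatrix (q : ℝ) (a b : ℕ → ℝ≥0) (w : ℕ → ℕ → ℝ≥0) (j k : ℕ) : ℝ≥0 :=
  w j k / b j ^ q * (b j / a k)

lemma transportMatrix_le_one (hq : 1 ≤ q) (hw : IsMonotoneCoupling w (a · ^ q) (b · ^ q))
    (ha : Antitone a) (hab : ∀ j, b j ≠ 0 → a j ≤ b j) (j k : ℕ) :
    transportMatrix q a b w j k ≤ 1 := by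
  have hq0 : 0 < q := by linarith
  by_cases h : w j k = 0
  · simp [transportMatrix, h]
  have hak := hw.ne_zero_fst hq0 h
  have hbj := hw.ne_zero_snd hq0 h
  rw [transportMatrix, div_mul_div_comm]
  refine div_le_one_of_le₀ ?_ zero_le
  calc w j k * b j ≤ a k ^ q * b j := by gcongr; exact hw.le_fst j k
    _ = a k ^ (q - 1) * (a k * b j) := by rw [← mul_assoc, NNReal.rpow_sub_one hak,
        div_mul_cancel₀ _ hak]
    _ ≤ b j ^ (q - 1) * (a k * b j) := by
        gcongr ?_ * _
        exact NNReal.rpow_le_rpow (hw.le_of_antitone hq0 ha hab h) (by linarith)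
    _ = b j ^ q * a k := by rw [NNReal.rpow_sub_one hbj]; field_simp

/-- For `r ≤ 1` each column has at most two nonzero entries, all at most `1`; for `1 ≤ r ≤ q`
Schur's test applies because `b j / a k ≥ 1` wherever `w j k ≠ 0`. -/
lemma matrixBounded_transportMatrix (hq : 1 ≤ q)
    (hw : IsMonotoneCoupling w (a · ^ q) (b · ^ q)) (ha : Antitone a)
    (hab : ∀ j, b j ≠ 0 → a j ≤ b j) {r : ℝ} (hr : 0 < r) (hrq : r ≤ q) :
    MatrixBounded r (transportMatrix q a b w) := by
  have hq0 : 0 < q := by linarith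
  obtain hr1 | hr1 := le_total r 1
  · choose S hScard hS using hw.exists_finset_card_le_two hq0 ha hab
    exact matrixBounded_of_le_one hr hr1 (transportMatrix_le_one hq hw ha hab) hScard
      fun j k hj => by simp [transportMatrix, hS k j hj]
  refine matrixBounded_of_schur_test (A := 1) hr1 (fun j => ?_) fun k => ?_
  · simp only [div_eq_mul_inv, ENNReal.coe_mul, ENNReal.tsum_mul_right, hw.tsum_row]
    exact mod_cast mul_inv_le_one
  calc ∑' j, ((w j k / b j ^ q : ℝ≥0) : ℝ≥0∞) * ((b j / a k : ℝ≥0) : ℝ≥0∞) ^ r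
      ≤ ∑' j, (w j k : ℝ≥0∞) * ((a k ^ q)⁻¹ : ℝ≥0) := ENNReal.tsum_le_tsum fun j => ?_
    _ ≤ ((a k ^ q : ℝ≥0) : ℝ≥0∞) * ((a k ^ q)⁻¹ : ℝ≥0) := by
        rw [ENNReal.tsum_mul_right]
        gcongr
        exact hw.tsum_col_le k
    _ ≤ (1 : ℝ≥0) := mod_cast mul_inv_le_one
  by_cases h : w j k = 0
  · simp [h]
  have hak := hw.ne_zero_fst hq0 h
  have hbj := hw.ne_zero_snd hq0 h
  rw [← ENNReal.coe_rpow_of_nonneg _ hr.le]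
  norm_cast
  calc w j k / b j ^ q * (b j / a k) ^ r ≤ w j k / b j ^ q * (b j / a k) ^ q := by
        gcongr
        exact (one_le_div (pos_iff_ne_zero.2 hak)).2 (hw.le_of_antitone hq0 ha hab h)
    _ = w j k * (a k ^ q)⁻¹ := by
        have := (NNReal.rpow_pos (pos_iff_ne_zero.2 hbj) (p := q)).ne'
        rw [NNReal.div_rpow]
        field_simp

lemma tsum_transportMatrix_mul (hq : 0 < q) (hw : IsMonotoneCoupling w (a · ^ q) (b · ^ q))
    (j : ℕ) : ∑' k, (transportMatrix q a b w j k : ℝ≥0∞) * a k = b j := by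
  have hentry : ∀ k, (transportMatrix q a b w j k : ℝ≥0∞) * a k =
      w j k * (b j / b j ^ q : ℝ≥0) := fun k => by
    norm_cast
    by_cases h : w j k = 0
    · simp [transportMatrix, h]
    have hak := hw.ne_zero_fst hq h
    rw [transportMatrix]
    field_simp
  simp only [hentry, ENNReal.tsum_mul_right, hw.tsum_row]
  norm_cast
  by_cases hbj : b j = 0
  · simp [hbj]
  exact mul_div_cancel₀ _ (NNReal.rpow_pos (pos_iff_ne_zero.2 hbj)).ne'

end Transport

namespace IsInterpolationSpace

variable {𝕜 : Type*} [RCLike 𝕜] {E : NormedSeqSpace 𝕜} {p q : ℝ}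

/-- Only the part of `v` that exceeds `u` has to be transported: there `|u k| ≤ |u j| ≤ |v j|`
for `j ≤ k`, which is what bounds the transport matrix. -/
lemma mem_of_antitone (hE : E.IsQuasiBanach) (hp : 0 < p) (hpq : p ≤ q) (hq : 1 ≤ q)
    (h : IsInterpolationSpace (ellp 𝕜 (ENNReal.ofReal p)) (ellp 𝕜 (ENNReal.ofReal q)) E)
    {u v : ℕ → 𝕜} (hu : u ∈ E.carrier) (hanti : Antitone fun k => ‖u k‖₊)
    (hvu : ∀ n, ∑' i, ‖v (i + n)‖ₑ ^ q ≤ ∑' i, ‖u (i + n)‖ₑ ^ q) : v ∈ E.carrier := by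
  have hq0 : 0 < q := by linarith
  let v' : ℕ → 𝕜 := fun k => if ‖u k‖₊ ≤ ‖v k‖₊ then v k else 0
  have hv' : ∀ k, ‖v' k‖₊ ≤ ‖v k‖₊ := fun k => by dsimp only [v']; split_ifs <;> simp
  have hrest : ∀ k, ‖(v - v') k‖ ≤ ‖u k‖ := fun k => by
    dsimp only [v', Pi.sub_apply]
    split_ifs with huv
    exacts [by simp, by simpa using NNReal.coe_le_coe.2 (not_le.1 huv).le]
  have huv' : ∀ k, ‖v' k‖₊ ≠ 0 → ‖u k‖₊ ≤ ‖v' k‖₊ := fun k hk => by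
    dsimp only [v'] at hk ⊢
    split_ifs at hk ⊢ with huv
    exacts [huv, absurd nnnorm_zero hk]
  have hcoe : ∀ z : 𝕜, ((‖z‖₊ ^ q : ℝ≥0) : ℝ≥0∞) = ‖z‖ₑ ^ q := fun z =>
    ENNReal.coe_rpow_of_nonneg _ hq0.le
  have hle : ∀ n, ∑' i, ((‖v' (i + n)‖₊ ^ q : ℝ≥0) : ℝ≥0∞) ≤
      ∑' i, ((‖u (i + n)‖₊ ^ q : ℝ≥0) : ℝ≥0∞) := fun n => by
    simp only [hcoe]
    refine (ENNReal.tsum_le_tsum fun i => ?_).trans (hvu n)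
    gcongr
    exact enorm_le_iff_norm_le.2 (hv' _)
  have husum : ∑' k, ((‖u k‖₊ ^ q : ℝ≥0) : ℝ≥0∞) ≠ ∞ := by
    simpa only [hcoe] using h.tsum_rpow_ne_top hp hpq hu
  have hus := ENNReal.tsum_coe_ne_top_iff_summable.1 husum
  have hvs : Summable fun k => ‖v' k‖₊ ^ q :=
    ENNReal.tsum_coe_ne_top_iff_summable.1 (ne_top_of_le_ne_top husum (hle 0))
  obtain ⟨w, hw⟩ := exists_isMonotoneCoupling hus hvs fun n => by
    have := hle n
    rwa [← ENNReal.coe_tsum ((NNReal.summable_nat_add_iff n).2 hvs),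
      ← ENNReal.coe_tsum ((NNReal.summable_nat_add_iff n).2 hus), ENNReal.coe_le_coe] at this
  have hM : ∀ {r : ℝ}, 0 < r → r ≤ q → MatrixBounded r _ :=
    matrixBounded_transportMatrix hq hw hanti huv'
  have hv'E : v' ∈ E.carrier :=
    h.mem_of_enorm_le_tsum hE hp hpq (hM hp hpq) (hM hq0 le_rfl) hu fun j =>
      (tsum_transportMatrix_mul hq0 hw j).ge
  simpa using E.carrier.add_mem hv'E (hE.mem_of_le hu hrest)

lemma mem_of_tailDominated (hE : E.IsQuasiBanach) (hp : 0 < p) (hpq : p ≤ q) (hq : 1 ≤ q)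
    (h : IsInterpolationSpace (ellp 𝕜 (ENNReal.ofReal p)) (ellp 𝕜 (ENNReal.ofReal q)) E)
    {u v : ℕ → 𝕜} (hu : u ∈ E.carrier)
    (hvu : TailDominated (fun k => ‖v k‖ₑ ^ q) fun k => ‖u k‖ₑ ^ q) : v ∈ E.carrier := by
  have hq0 : 0 < q := by linarith
  have husum := h.tsum_rpow_ne_top hp hpq hu
  have hvsum := ne_top_of_le_ne_top husum hvu.tsum_le
  obtain ⟨σ, hσ⟩ := exists_isDecreasingEnumeration fun ε hε =>
    ENNReal.finite_const_le_of_tsum_ne_top husum (ε := ε) hε.ne'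
  obtain ⟨ρ, hρ⟩ := exists_isDecreasingEnumeration fun ε hε =>
    ENNReal.finite_const_le_of_tsum_ne_top hvsum (ε := ε) hε.ne'
  have hvρ : ∀ k ∉ Set.range ρ, v k = 0 := fun k hk => by
    simpa [hq0, hq0.le] using hρ.eq_zero_of_notMem_range k hk
  have hsorted : TailDominated (fun i => ‖v (ρ i)‖ₑ ^ q) fun i => ‖u (σ i)‖ₑ ^ q :=
    ((tailDominated_comp _ hρ.injective).trans hvu).trans
      (tailDominated_of_comp hσ.injective hσ.eq_zero_of_notMem_range)
  refine h.mem_of_comp_mem hE hp hpq hρ.injective (h.mem_of_antitone hE hp hpq hq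
    (h.comp_mem hE hp hpq hu hσ.injective) (fun i j hij => ?_)
    ((tailDominated_iff_of_antitone hρ.antitone hσ.antitone).1 hsorted)) hvρ
  exact enorm_le_iff_norm_le.1 ((ENNReal.rpow_le_rpow_iff hq0).1 (hσ.antitone hij))

end IsInterpolationSpace

/-! ### Automatic uniformity -/

namespace NormedSeqSpace

variable {𝕜 : Type*} [RCLike 𝕜] {E : NormedSeqSpace 𝕜} {q : ℝ}

/-- `E` contains every sequence whose `q`-th power is tail dominated by that of an element of `E`;
this is condition (c) without reference to rearrangements. -/
def IsTailClosed (E : NormedSeqSpace 𝕜) (q : ℝ) : Prop :=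
  ∀ u ∈ E.carrier, ∀ v : ℕ → 𝕜,
    TailDominated (fun k => ‖v k‖ₑ ^ q) (fun k => ‖u k‖ₑ ^ q) → v ∈ E.carrier

/-- A sequence with `∑ |u|^q = ∞` tail dominates everything, so it cannot lie in a closed `E`
other than `ℓ^∞`. -/
lemma le_ellp_of_forall_tailMajorizedPow_mem (hq : 0 < q) (hE_sub : E.carrier ≤ (ellp 𝕜 ∞).carrier)
    (hE_ne_top : E.carrier ≠ (ellp 𝕜 ∞).carrier)
    (hc : ∀ (u : E.carrier) (v : ℕ → 𝕜), v ∈ (ellp 𝕜 ∞).carrier →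
      TailMajorizedPow q v u → v ∈ E.carrier) :
    E.carrier ≤ (ellp 𝕜 (ENNReal.ofReal q)).carrier := by
  refine fun u hu => (mem_ellp_iff hq u).2 fun htop => ?_
  refine hE_ne_top (hE_sub.antisymm fun v hv => hc ⟨u, hu⟩ v hv ?_)
  rw [tailMajorizedPow_iff hq.le]
  refine fun F => ⟨∅, by simp, le_top.trans (top_le_iff.2 ?_)⟩
  have hF : ∑ k ∈ F, ‖u k‖ₑ ^ q ≠ ∞ :=
    ENNReal.sum_ne_top.2 fun k _ => ENNReal.rpow_ne_top_of_nonneg hq.le enorm_ne_top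
  have hsum := sum_add_sumOff (fun k => ‖u k‖ₑ ^ q) F
  rw [htop, ENNReal.add_eq_top] at hsum
  exact hsum.resolve_left hF

lemma mem_ellp_top_of_tailDominated (hq : 0 < q)
    (hEq : E.carrier ≤ (ellp 𝕜 (ENNReal.ofReal q)).carrier) {u v : ℕ → 𝕜} (hu : u ∈ E.carrier)
    (hvu : TailDominated (fun k => ‖v k‖ₑ ^ q) fun k => ‖u k‖ₑ ^ q) :
    v ∈ (ellp 𝕜 ∞).carrier :=
  ellp_mono le_top <| (mem_ellp_iff hq v).2 <|
    ne_top_of_le_ne_top ((mem_ellp_iff hq u).1 (hEq hu)) hvu.tsum_le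

lemma isTailClosed_of_forall_tailMajorizedPow_mem (hq : 0 < q)
    (hEq : E.carrier ≤ (ellp 𝕜 (ENNReal.ofReal q)).carrier)
    (hc : ∀ (u : E.carrier) (v : ℕ → 𝕜), v ∈ (ellp 𝕜 ∞).carrier →
      TailMajorizedPow q v u → v ∈ E.carrier) : E.IsTailClosed q := fun u hu v hvu =>
  hc ⟨u, hu⟩ v (mem_ellp_top_of_tailDominated hq hEq hu hvu)
    ((tailMajorizedPow_iff hq.le v u).2 hvu)

namespace IsTailClosed

lemma comp_mem (hE : E.IsTailClosed q) {x : ℕ → 𝕜} (hx : x ∈ E.carrier) {τ : ℕ → ℕ}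
    (hτ : τ.Injective) : x ∘ τ ∈ E.carrier :=
  hE x hx _ (tailDominated_comp (fun k => ‖x k‖ₑ ^ q) hτ)

lemma extend_mem (hE : E.IsTailClosed q) (hq : 0 < q) {x : ℕ → 𝕜} (hx : x ∈ E.carrier)
    {τ : ℕ → ℕ} (hτ : τ.Injective) : Function.extend τ x 0 ∈ E.carrier := by
  refine hE x hx _ ?_
  have h := tailDominated_of_comp (φ := fun k => ‖Function.extend τ x 0 k‖ₑ ^ q) hτ fun k hk => by
    simp [Function.extend_apply' x (0 : ℕ → 𝕜) k hk, hq]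
  simpa only [Function.comp_def, hτ.extend_apply] using h

lemma exists_bound_comp (hE : E.IsTailClosed q) (hqb : E.IsQuasiBanach) {τ : ℕ → ℕ}
    (hτ : τ.Injective) :
    ∃ C, 0 < C ∧ ∀ x ∈ E.carrier, E.extQnorm (x ∘ τ) ≤ C * E.extQnorm x :=
  hqb.exists_bound_of_monotone (fun _ _ => rfl) (fun _ _ h k => h (τ k)) fun _ hx =>
    hE.comp_mem hx hτ

lemma exists_bound_extend (hE : E.IsTailClosed q) (hqb : E.IsQuasiBanach) (hq : 0 < q)
    {τ : ℕ → ℕ} (hτ : τ.Injective) :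
    ∃ C, 0 < C ∧ ∀ x ∈ E.carrier, E.extQnorm (Function.extend τ x 0) ≤ C * E.extQnorm x := by
  refine hqb.exists_bound_of_monotone (fun a x => ?_) (fun x y h k => ?_) fun x hx =>
    hE.extend_mem hq hx hτ
  · simpa using (Function.extend_smul a τ x (0 : ℕ → 𝕜))
  · by_cases hk : ∃ i, τ i = k
    · obtain ⟨i, rfl⟩ := hk
      simpa only [hτ.extend_apply] using h i
    · simp [Function.extend_apply' _ _ k hk]

end IsTailClosed

end NormedSeqSpace

/-- The direct sum of countably many sequences, reindexed by `ℕ`. -/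
def directSum {α : Type*} (x : ℕ → ℕ → α) (k : ℕ) : α :=
  x k.unpair.1 k.unpair.2

lemma directSum_comp_pair {α : Type*} (x : ℕ → ℕ → α) (n : ℕ) :
    directSum x ∘ Nat.pair n = x n := by
  funext m
  simp [directSum]

lemma tailDominated_directSum {ψ φ : ℕ → ℕ → ℝ≥0∞} (h : ∀ n, TailDominated (ψ n) (φ n)) :
    TailDominated (directSum ψ) (directSum φ) := by
  let e : ℕ ≃ Σ _ : ℕ, ℕ := Nat.pairEquiv.symm.trans (Equiv.sigmaEquivProd ℕ ℕ).symm
  have hσ := tailDominated_sigma h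
  exact ((tailDominated_comp _ e.injective).trans hσ).trans
    (tailDominated_of_comp e.injective fun k hk => absurd (e.surjective k) hk)

lemma pair_right_injective (n : ℕ) : (Nat.pair n).Injective := fun _ _ h =>
  (Nat.pair_eq_pair.1 h).2

namespace NormedSeqSpace

variable {𝕜 : Type*} [RCLike 𝕜] {E : NormedSeqSpace 𝕜} {q : ℝ}

lemma enorm_smul_rpow (hq : 0 ≤ q) (a : 𝕜) (x : ℕ → 𝕜) :
    (fun k => ‖(a • x) k‖ₑ ^ q) = fun k => ‖a‖ₑ ^ q * ‖x k‖ₑ ^ q := by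
  funext k
  rw [Pi.smul_apply, enorm_smul, ENNReal.mul_rpow_of_nonneg _ _ hq]

namespace IsTailClosed

lemma exists_directSum_mem (hE : E.IsTailClosed q) (hqb : E.IsQuasiBanach) (hq : 0 < q) :
    ∃ ε : ℕ → ℝ, (∀ n, 0 < ε n) ∧ ∀ u : ℕ → ℕ → 𝕜, (∀ n, u n ∈ E.carrier) →
      (∀ n, E.extQnorm (u n) ≤ ε n) → directSum u ∈ E.carrier := by
  obtain ⟨K, hK⟩ := hqb.exists_isConcavityModulus
  have hK0 : 0 < K := zero_lt_one.trans_le hK.one_le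
  choose C hC0 hC using fun n => hE.exists_bound_extend hqb hq (pair_right_injective n)
  refine ⟨fun n => (C n)⁻¹ * ((2 * K) ^ (n + 1))⁻¹, fun n => by have := hC0 n; positivity,
    fun u hu huε => ?_⟩
  obtain ⟨y, hy, -, hdom⟩ := hqb.exists_majorant hK (A := 1)
    (fun n => hE.extend_mem hq (hu n) (pair_right_injective n)) fun n => by
      have hCn := hC0 n
      calc _ ≤ C n * E.extQnorm (u n) := hC n _ (hu n)
        _ ≤ C n * ((C n)⁻¹ * ((2 * K) ^ (n + 1))⁻¹) := by gcongr; exact huε n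
        _ = 1 * ((2 * K) ^ (n + 1))⁻¹ := by field_simp
  refine hqb.mem_of_le hy fun k => ?_
  have hk := hdom k.unpair.1 (Nat.pair k.unpair.1 k.unpair.2)
  rwa [(pair_right_injective _).extend_apply, Nat.pair_unpair] at hk

/-- If the bound failed for pairs `u n`, `v n` then, after scaling, the direct sum of the `u n`
would lie in `E`, hence so would that of the `v n`, which has unbounded restrictions. -/
lemma exists_bound (hE : E.IsTailClosed q) (hqb : E.IsQuasiBanach) (hq : 0 < q) :
    ∃ c, 0 < c ∧ ∀ u ∈ E.carrier, ∀ v : ℕ → 𝕜,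
      TailDominated (fun k => ‖v k‖ₑ ^ q) (fun k => ‖u k‖ₑ ^ q) →
        E.extQnorm v ≤ c * E.extQnorm u := by
  obtain ⟨ε, hε0, hε⟩ := hE.exists_directSum_mem hqb hq
  choose D hD0 hD using fun n => hE.exists_bound_comp hqb (pair_right_injective n)
  have hnorm : ∀ n, ‖((D n : ℝ) : 𝕜)‖ = D n := fun n => by
    rw [RCLike.norm_ofReal, abs_of_pos (hD0 n)]
  refine hqb.exists_bound_of_homogeneous hE (fun a u v h => ?_) (fun v h => ?_)
    (ε := fun n => ε n / D n) (fun n => div_pos (hε0 n) (hD0 n)) fun u v hu huε huv => ?_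
  · rw [enorm_smul_rpow hq.le, enorm_smul_rpow hq.le]
    exact h.const_mul _
  · have hv := h.tsum_le
    simp only [Pi.zero_apply, enorm_zero, ENNReal.zero_rpow_of_pos hq, tsum_zero,
      nonpos_iff_eq_zero, ENNReal.tsum_eq_zero] at hv
    funext k
    simpa [hq, hq.le] using hv k
  let u' : ℕ → ℕ → 𝕜 := fun n => ((D n : ℝ) : 𝕜) • u n
  let v' : ℕ → ℕ → 𝕜 := fun n => ((D n : ℝ) : 𝕜) • v n
  have hU : directSum u' ∈ E.carrier := hε u' (fun n => E.carrier.smul_mem _ (hu n)) fun n => by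
    rw [hqb.extQnorm_smul _ (hu n), hnorm, mul_comm, ← le_div_iff₀ (hD0 n)]
    exact huε n
  have hV : directSum v' ∈ E.carrier :=
    hE _ hU _ <| tailDominated_directSum (ψ := fun n k => ‖v' n k‖ₑ ^ q)
      (φ := fun n k => ‖u' n k‖ₑ ^ q) fun n => by
        simp only [u', v', enorm_smul_rpow hq.le]
        exact (huv n).const_mul _
  refine ⟨E.extQnorm (directSum v'), fun n => le_of_mul_le_mul_left ?_ (hD0 n)⟩
  have hn := hD n _ hV
  rwa [directSum_comp_pair, hqb.extQnorm_smul _ (hE _ (hu n) _ (huv n)), hnorm] at hn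

end IsTailClosed

end NormedSeqSpace

/-! ### Averages of sequences with controlled dilations -/

section Dilations

/-- `y` dominates every dyadic dilation `k ↦ a ⌊k / 2 ^ j⌋` of `a`, up to a factor growing
geometrically in `j`. -/
def IsDilationMajorant (m : ℕ) (a y : ℕ → ℝ≥0) : Prop :=
  ∀ j k, a (k / 2 ^ j) ≤ (2 ^ m) ^ j * y k

lemma sum_range_inv_sqrt_le (n : ℕ) :
    ∑ i ∈ Finset.range n, (NNReal.sqrt (i + 1))⁻¹ ≤ 2 * NNReal.sqrt n := by
  induction n with
  | zero => simp
  | succ n ih =>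
    have hstep : (√((n : ℝ) + 1))⁻¹ + 2 * √(n : ℝ) ≤ 2 * √((n : ℝ) + 1) := by
      have hpos : 0 < √((n : ℝ) + 1) := Real.sqrt_pos.2 (by positivity)
      rw [← le_sub_iff_add_le, inv_le_iff_one_le_mul₀ hpos]
      nlinarith [sq_nonneg (√((n : ℝ) + 1) - √(n : ℝ)), Real.sq_sqrt (Nat.cast_nonneg (α := ℝ) n),
        Real.sq_sqrt (show (0 : ℝ) ≤ n + 1 by positivity)]
    rw [Finset.sum_range_succ, add_comm]
    calc _ ≤ (NNReal.sqrt (n + 1))⁻¹ + 2 * NNReal.sqrt n := by gcongr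
      _ ≤ 2 * NNReal.sqrt (n + 1 : ℕ) := by
        rw [← NNReal.coe_le_coe]
        push_cast
        exact hstep

lemma exists_div_two_pow_le {i k : ℕ} (h : i ≤ k) :
    ∃ j : ℕ, k / 2 ^ j ≤ i ∧ 2 ^ j * (i + 1) ≤ 2 * (k + 1) := by
  have hex : ∃ j : ℕ, k < 2 ^ j * (i + 1) := ⟨k, by nlinarith [k.lt_two_pow_self]⟩
  classical
  refine ⟨Nat.find hex, ?_, ?_⟩
  · rw [← Nat.lt_succ_iff, Nat.div_lt_iff_lt_mul (by positivity), mul_comm]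
    exact Nat.find_spec hex
  · cases hj : Nat.find hex with
    | zero => omega
    | succ j =>
      have := Nat.find_min hex (show j < Nat.find hex by omega)
      rw [pow_succ]
      nlinarith

namespace IsDilationMajorant

variable {m : ℕ} {a y : ℕ → ℝ≥0}

lemma rpow_mul_sqrt_le (h : IsDilationMajorant m a y) (hm : m ≠ 0) (ha : Antitone a) {i k : ℕ}
    (hik : i ≤ k) :
    a i ^ (2 * m : ℝ)⁻¹ * NNReal.sqrt (i + 1) ≤ 2 * NNReal.sqrt (k + 1) * y k ^ (2 * m : ℝ)⁻¹ := by
  obtain ⟨j, hj, hij⟩ := exists_div_two_pow_le hik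
  have hpow : (((2 : ℝ≥0) ^ m) ^ j) ^ (2 * m : ℝ)⁻¹ = NNReal.sqrt (2 ^ j) := by
    rw [NNReal.sqrt_eq_rpow, ← NNReal.rpow_natCast, ← NNReal.rpow_natCast, ← NNReal.rpow_natCast,
      ← NNReal.rpow_mul, ← NNReal.rpow_mul, ← NNReal.rpow_mul]
    congr 1
    field_simp
  have hsqrt : NNReal.sqrt (2 ^ j) * NNReal.sqrt (i + 1) ≤ 2 * NNReal.sqrt (k + 1) := by
    rw [← NNReal.sqrt_mul, NNReal.sqrt_le_iff_le_sq, mul_pow, NNReal.sq_sqrt]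
    calc (2 ^ j * (i + 1) : ℝ≥0) ≤ 2 * (k + 1) := by exact_mod_cast hij
      _ ≤ 2 ^ 2 * (k + 1) := by gcongr; norm_num
  calc a i ^ (2 * m : ℝ)⁻¹ * NNReal.sqrt (i + 1)
      ≤ ((2 ^ m) ^ j * y k) ^ (2 * m : ℝ)⁻¹ * NNReal.sqrt (i + 1) := by
        gcongr
        exact (ha hj).trans (h j k)
    _ = NNReal.sqrt (2 ^ j) * NNReal.sqrt (i + 1) * y k ^ (2 * m : ℝ)⁻¹ := by
        rw [NNReal.mul_rpow, hpow, mul_right_comm]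
    _ ≤ _ := by gcongr

lemma sum_range_rpow_le (h : IsDilationMajorant m a y) (hm : m ≠ 0) (ha : Antitone a) (k : ℕ) :
    ∑ i ∈ Finset.range (k + 1), a i ^ (2 * m : ℝ)⁻¹ ≤ 4 * (k + 1) * y k ^ (2 * m : ℝ)⁻¹ := by
  calc ∑ i ∈ Finset.range (k + 1), a i ^ (2 * m : ℝ)⁻¹
      ≤ ∑ i ∈ Finset.range (k + 1),
          2 * NNReal.sqrt (k + 1) * y k ^ (2 * m : ℝ)⁻¹ * (NNReal.sqrt (i + 1))⁻¹ :=
        Finset.sum_le_sum fun i hi => by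
          rw [le_mul_inv_iff₀ (NNReal.sqrt_pos.2 (by positivity))]
          exact h.rpow_mul_sqrt_le hm ha (Nat.lt_succ_iff.1 (Finset.mem_range.1 hi))
    _ ≤ 2 * NNReal.sqrt (k + 1) * y k ^ (2 * m : ℝ)⁻¹ * (2 * NNReal.sqrt (k + 1)) := by
        rw [← Finset.mul_sum]
        gcongr
        exact_mod_cast sum_range_inv_sqrt_le (k + 1)
    _ = 4 * (NNReal.sqrt (k + 1) * NNReal.sqrt (k + 1)) * y k ^ (2 * m : ℝ)⁻¹ := by ring
    _ = _ := by rw [NNReal.mul_self_sqrt]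

lemma average_rpow_le (h : IsDilationMajorant m a y) (hm : m ≠ 0) (ha : Antitone a) {n k : ℕ}
    (hnk : n ≤ k) (hkn : k < 3 * n) :
    (∑ i ∈ Finset.range n, (a i : ℝ≥0∞) ^ (2 * m : ℝ)⁻¹) / n ≤ 12 * y k ^ (2 * m : ℝ)⁻¹ := by
  have hn : (n : ℝ≥0∞) ≠ 0 := by simp; omega
  have hsum : ∑ i ∈ Finset.range n, a i ^ (2 * m : ℝ)⁻¹ ≤ 12 * y k ^ (2 * m : ℝ)⁻¹ * n :=
    calc ∑ i ∈ Finset.range n, a i ^ (2 * m : ℝ)⁻¹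
        ≤ ∑ i ∈ Finset.range (k + 1), a i ^ (2 * m : ℝ)⁻¹ :=
          Finset.sum_le_sum_of_subset (Finset.range_subset_range.2 (by omega))
      _ ≤ 4 * (k + 1) * y k ^ (2 * m : ℝ)⁻¹ := h.sum_range_rpow_le hm ha k
      _ ≤ 4 * (3 * n) * y k ^ (2 * m : ℝ)⁻¹ := by
          gcongr
          exact_mod_cast hkn
      _ = _ := by ring
  rw [ENNReal.div_le_iff hn (ENNReal.natCast_ne_top n)]
  simp_rw [← ENNReal.coe_rpow_of_nonneg _ (show 0 ≤ (2 * m : ℝ)⁻¹ by positivity)]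
  exact_mod_cast hsum

end IsDilationMajorant

end Dilations

/-! ### The K-functional of the couple `(ℓ^p, ℓ^q)` -/

section KFunctional

variable {ι : Type*} {p q : ℝ}

lemma sumOff_add (φ ψ : ι → ℝ≥0∞) (F : Finset ι) :
    sumOff (fun k => φ k + ψ k) F = sumOff φ F + sumOff ψ F := by
  simp only [sumOff, Set.indicator_add, ENNReal.tsum_add]

lemma rpow_sub_one_mul_self {r : ℝ} (hr : 1 ≤ r) (t : ℝ≥0∞) : t ^ (r - 1) * t = t ^ r := by
  conv_lhs => rw [← ENNReal.rpow_one t, ← ENNReal.rpow_mul, one_mul,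
    ← ENNReal.rpow_add_of_nonneg _ _ (sub_nonneg.2 hr) zero_le_one, sub_add_cancel]

lemma rpow_le_rpow_sub_one_mul {b t : ℝ≥0∞} {r : ℝ} (hr : 1 ≤ r) (h : b ≤ t) :
    b ^ r ≤ t ^ (r - 1) * b := by
  rw [← rpow_sub_one_mul_self hr]
  gcongr

/-- Chebyshev: at most `n` terms of `x ^ p` exceed `P / n`, and these are the deleted ones. -/
lemma exists_sumOff_rpow_le (hp : 0 < p) (hpq : p ≤ q) {x : ι → ℝ≥0∞} {P : ℝ≥0∞} (hP : P ≠ ∞)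
    (hx : ∑' k, x k ^ p ≤ P) {n : ℕ} (hn : n = 0 → P = 0) :
    ∃ F : Finset ι, F.card ≤ n ∧ sumOff (fun k => x k ^ q) F ≤ n * (P / n) ^ (q / p) := by
  have hq : 0 < q := hp.trans_le hpq
  rcases eq_or_ne P 0 with rfl | hP0
  · have hx0 (k : ι) : x k = 0 := by
      rw [nonpos_iff_eq_zero, ENNReal.tsum_eq_zero] at hx
      simpa [hp, hp.not_gt] using hx k
    exact ⟨∅, by simp, by simp [hx0, hq]⟩
  have hn0 : (n : ℝ≥0∞) ≠ 0 := by exact_mod_cast mt hn hP0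
  have hnt : (n : ℝ≥0∞) ≠ ∞ := ENNReal.natCast_ne_top n
  have hratio : 1 ≤ q / p := (one_le_div hp).2 hpq
  obtain ⟨hfin, hcard⟩ :=
    ENNReal.finset_card_const_le_le_of_tsum_le hP hx (ENNReal.div_ne_zero.2 ⟨hP0, hnt⟩)
  have hdiv : P / (P / n) = n := by
    rw [ENNReal.div_eq_inv_mul, ENNReal.inv_div (Or.inl hnt) (Or.inl hn0),
      ENNReal.div_mul_cancel hP0 hP]
  refine ⟨hfin.toFinset, by rw [hdiv] at hcard; exact_mod_cast hcard, ?_⟩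
  calc sumOff (fun k => x k ^ q) hfin.toFinset
      ≤ ∑' k, (P / n) ^ (q / p - 1) * x k ^ p := by
        refine ENNReal.tsum_le_tsum (Set.indicator_le' (fun k hk => ?_) fun _ _ => zero_le)
        have hk' : x k ^ p ≤ P / n := by
          have : ¬ P / n ≤ x k ^ p := by simpa using hk
          exact (not_le.1 this).le
        calc x k ^ q = (x k ^ p) ^ (q / p) := by rw [← ENNReal.rpow_mul, mul_div_cancel₀ _ hp.ne']
          _ ≤ _ := rpow_le_rpow_sub_one_mul hratio hk'
    _ ≤ (P / n) ^ (q / p - 1) * P := by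
        rw [ENNReal.tsum_mul_left]
        gcongr
    _ = n * ((P / n) ^ (q / p - 1) * (P / n)) := by
        rw [mul_left_comm, ENNReal.mul_div_cancel hn0 hnt]
    _ = n * (P / n) ^ (q / p) := by rw [rpow_sub_one_mul_self hratio]

lemma exists_sumOff_rpow_le_of_le_add (hp : 0 < p) (hpq : p ≤ q) (hq : 1 ≤ q)
    {x z w : ι → ℝ≥0∞} (hx : x ≤ z + w) {P Q : ℝ≥0∞} (hP : P ≠ ∞) (hz : ∑' k, z k ^ p ≤ P)
    (hw : ∑' k, w k ^ q ≤ Q) {n : ℕ} (hn : n = 0 → P = 0) :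
    ∃ F : Finset ι, F.card ≤ n ∧
      sumOff (fun k => x k ^ q) F ≤ 2 ^ (q - 1) * (n * (P / n) ^ (q / p) + Q) := by
  obtain ⟨F, hF, hle⟩ := exists_sumOff_rpow_le hp hpq hP hz hn
  refine ⟨F, hF, ?_⟩
  calc sumOff (fun k => x k ^ q) F
      ≤ sumOff (fun k => 2 ^ (q - 1) * (z k ^ q + w k ^ q)) F := by
        refine sumOff_mono_left (fun k => ?_) F
        have hxk : x k ≤ z k + w k := hx k
        exact (ENNReal.rpow_le_rpow hxk (by positivity)).trans
          (ENNReal.rpow_add_le_mul_rpow_add_rpow _ _ hq)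
    _ = 2 ^ (q - 1) * (sumOff (fun k => z k ^ q) F + sumOff (fun k => w k ^ q) F) := by
        rw [sumOff_const_mul, sumOff_add]
    _ ≤ 2 ^ (q - 1) * (n * (P / n) ^ (q / p) + Q) := by
        gcongr
        exact (sumOff_le_tsum _ F).trans hw

lemma mul_le_sumOff_of_le {φ : ℕ → ℝ≥0∞} {n : ℕ} {t : ℝ≥0∞}
    (h : ∀ k, n ≤ k → k < 3 * n → t ≤ φ k) {F : Finset ℕ} (hF : F.card ≤ n) :
    n * t ≤ sumOff φ F := by
  have hcard : n ≤ (Finset.Ico n (3 * n) \ F).card := by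
    have := Finset.le_card_sdiff F (Finset.Ico n (3 * n))
    rw [Nat.card_Ico] at this
    omega
  calc (n : ℝ≥0∞) * t ≤ (Finset.Ico n (3 * n) \ F).card • t := by
        rw [nsmul_eq_mul]
        gcongr
    _ ≤ ∑ k ∈ Finset.Ico n (3 * n) \ F, φ k := by
        refine Finset.card_nsmul_le_sum _ _ _ fun k hk => ?_
        rw [Finset.mem_sdiff, Finset.mem_Ico] at hk
        exact h k hk.1.1 hk.1.2
    _ ≤ sumOff φ F := by
        rw [sumOff_eq_sum_sdiff_add φ F (Finset.Ico n (3 * n))]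
        exact le_self_add

lemma IsDilationMajorant.mul_average_rpow_le {m : ℕ} {a y : ℕ → ℝ≥0}
    (h : IsDilationMajorant m a y) (hm : m ≠ 0) (ha : Antitone a) (hp : p = (2 * m : ℝ)⁻¹)
    (hq : 0 ≤ q) {n : ℕ} {F : Finset ℕ} (hF : F.card ≤ n) :
    n * ((∑ i ∈ Finset.range n, (a i : ℝ≥0∞) ^ p) / n) ^ (q / p) ≤
      12 ^ (q / p) * sumOff (fun k => (y k : ℝ≥0∞) ^ q) F := by
  have hp0 : 0 < p := by rw [hp]; positivity
  rw [← sumOff_const_mul]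
  refine mul_le_sumOff_of_le (fun k hnk hkn => ?_) hF
  calc _ ≤ (12 * (y k : ℝ≥0∞) ^ p) ^ (q / p) := by
        gcongr
        rw [hp]
        exact h.average_rpow_le hm ha hnk hkn
    _ = 12 ^ (q / p) * (y k : ℝ≥0∞) ^ q := by
        rw [ENNReal.mul_rpow_of_nonneg _ _ (by positivity), ← ENNReal.rpow_mul,
          mul_div_cancel₀ _ hp0.ne']

end KFunctional

/-! ### Dilations in tail closed spaces -/

namespace NormedSeqSpace.IsTailClosed

variable {𝕜 : Type*} [RCLike 𝕜] {E : NormedSeqSpace 𝕜} {q : ℝ}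

lemma exists_bound_const_mul (hE : E.IsTailClosed q) (hqb : E.IsQuasiBanach) (hq : 0 < q)
    (Λ : ℝ≥0) :
    ∃ c, 0 ≤ c ∧ ∀ y ∈ E.carrier, ∀ v : ℕ → 𝕜,
      TailDominated (fun k => ‖v k‖ₑ ^ q) (fun k => Λ * ‖y k‖ₑ ^ q) →
        v ∈ E.carrier ∧ E.extQnorm v ≤ c * E.extQnorm y := by
  obtain ⟨c, hc, hbound⟩ := hE.exists_bound hqb hq
  let b : 𝕜 := ((Λ ^ q⁻¹ : ℝ≥0) : ℝ)
  have hb : ‖b‖ₑ ^ q = Λ := by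
    have hb' : ‖b‖ₑ = (Λ ^ q⁻¹ : ℝ≥0) := by
      simpa only [mul_one, enorm_one] using enorm_coe_mul (Λ ^ q⁻¹) (1 : 𝕜)
    rw [hb', ← ENNReal.coe_rpow_of_nonneg _ hq.le, NNReal.rpow_inv_rpow hq.ne']
  refine ⟨c * ‖b‖, by positivity, fun y hy v hv => ?_⟩
  rw [← hb, ← enorm_smul_rpow hq.le] at hv
  have hby := E.carrier.smul_mem b hy
  refine ⟨hE _ hby v hv, ?_⟩
  rw [mul_assoc, ← hqb.extQnorm_smul b hy]
  exact hbound _ hby v hv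

lemma exists_bound_div_two (hE : E.IsTailClosed q) (hqb : E.IsQuasiBanach) (hq : 0 < q) :
    ∃ L, 1 ≤ L ∧ ∀ u ∈ E.carrier, (fun k => u (k / 2)) ∈ E.carrier ∧
      E.extQnorm (fun k => u (k / 2)) ≤ L * E.extQnorm u := by
  obtain ⟨K, hK⟩ := hqb.exists_isConcavityModulus
  have hK0 : 0 < K := zero_lt_one.trans_le hK.one_le
  have heven : (fun k : ℕ => 2 * k).Injective := fun _ _ h => by simpa using h
  have hodd : (fun k : ℕ => 2 * k + 1).Injective := fun _ _ h => by simpa using h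
  obtain ⟨C, -, hC⟩ := hE.exists_bound_extend hqb hq heven
  obtain ⟨D, -, hD⟩ := hE.exists_bound_extend hqb hq hodd
  refine ⟨max 1 (K * (C + D)), le_max_left _ _, fun u hu => ?_⟩
  have hadd : (fun k => u (k / 2)) = Function.extend (fun k => 2 * k) u 0 +
      Function.extend (fun k => 2 * k + 1) u 0 := by
    funext k
    obtain ⟨i, rfl | rfl⟩ := k.even_or_odd'
    · rw [Pi.add_apply, heven.extend_apply u 0 i, Function.extend_apply' _ _ _ (by omega)]
      simp
    · rw [Pi.add_apply, hodd.extend_apply u 0 i, Function.extend_apply' _ _ _ (by omega)]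
      simp [show (2 * i + 1) / 2 = i by omega]
  have hmem₀ := hE.extend_mem hq hu heven
  have hmem₁ := hE.extend_mem hq hu hodd
  rw [hadd]
  refine ⟨E.carrier.add_mem hmem₀ hmem₁, ?_⟩
  calc _ ≤ K * (_ + _) := hK.add_le _ hmem₀ _ hmem₁
    _ ≤ K * (C * E.extQnorm u + D * E.extQnorm u) := by
        gcongr
        exacts [hC u hu, hD u hu]
    _ = K * (C + D) * E.extQnorm u := by ring
    _ ≤ _ := by
        gcongr
        exacts [hqb.extQnorm_nonneg u, le_max_right _ _]

lemma exists_bound_div_two_pow (hE : E.IsTailClosed q) (hqb : E.IsQuasiBanach) (hq : 0 < q) :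
    ∃ L, 1 ≤ L ∧ ∀ u ∈ E.carrier, ∀ j, (fun k => u (k / 2 ^ j)) ∈ E.carrier ∧
      E.extQnorm (fun k => u (k / 2 ^ j)) ≤ L ^ j * E.extQnorm u := by
  obtain ⟨L, hL1, hL⟩ := hE.exists_bound_div_two hqb hq
  refine ⟨L, hL1, fun u hu j => ?_⟩
  induction j with
  | zero => simpa using hu
  | succ j ih =>
    have hdiv : (fun k => u (k / 2 ^ (j + 1))) = fun k => u (k / 2 / 2 ^ j) := by
      funext k
      rw [Nat.div_div_eq_div_mul, pow_succ']
    obtain ⟨hmem, hle⟩ := hL _ ih.1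
    rw [hdiv]
    refine ⟨hmem, hle.trans ?_⟩
    rw [pow_succ', mul_assoc]
    gcongr
    exact ih.2

/-- Since the `j`-th dyadic dilation has norm at most `L ^ j`, the dilations of `a` can be summed
in `E` once the `j`-th one is divided by a large enough power `2 ^ (m * j)`. -/
lemma exists_isDilationMajorant (hE : E.IsTailClosed q) (hqb : E.IsQuasiBanach) (hq : 0 < q) :
    ∃ m ≠ 0, ∃ B, 0 ≤ B ∧ ∀ a ∈ E.carrier, ∃ y ∈ E.carrier, E.extQnorm y ≤ B * E.extQnorm a ∧
      IsDilationMajorant m (fun k => ‖a k‖₊) fun k => ‖y k‖₊ := by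
  obtain ⟨K, hK⟩ := hqb.exists_isConcavityModulus
  have hK0 : 0 < K := zero_lt_one.trans_le hK.one_le
  obtain ⟨L, hL1, hL⟩ := hE.exists_bound_div_two_pow hqb hq
  obtain ⟨m, hm⟩ := pow_unbounded_of_one_lt (2 * K * L) (one_lt_two : (1 : ℝ) < 2)
  have hm0 : m ≠ 0 := by
    rintro rfl
    nlinarith [hK.one_le, hm]
  refine ⟨m, hm0, K * (2 * K), by positivity, fun a ha => ?_⟩
  let b (j : ℕ) : 𝕜 := ((((2 : ℝ) ^ m) ^ j)⁻¹ : ℝ)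
  have hb (j : ℕ) : ‖b j‖ = (((2 : ℝ) ^ m) ^ j)⁻¹ := by
    rw [RCLike.norm_ofReal, abs_of_nonneg (by positivity)]
  obtain ⟨y, hy, hyn, hdom⟩ := hqb.exists_majorant hK (A := 2 * K * E.extQnorm a)
    (x := fun j => b j • fun k => a (k / 2 ^ j)) (fun j => E.carrier.smul_mem _ (hL a ha j).1)
    fun j => by
      rw [hqb.extQnorm_smul _ (hL a ha j).1, hb]
      have := hqb.extQnorm_nonneg a
      calc (((2 : ℝ) ^ m) ^ j)⁻¹ * E.extQnorm (fun k => a (k / 2 ^ j))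
          ≤ ((2 * K * L) ^ j)⁻¹ * (L ^ j * E.extQnorm a) := by
            gcongr
            exacts [hqb.extQnorm_nonneg _, (hL a ha j).2]
        _ = 2 * K * E.extQnorm a * ((2 * K) ^ (j + 1))⁻¹ := by
            rw [mul_pow (2 * K) L, pow_succ]
            field_simp
  refine ⟨y, hy, by linarith, fun j k => ?_⟩
  have hjk := hdom j k
  simp only [Pi.smul_apply, norm_smul, hb] at hjk
  rw [inv_mul_le_iff₀ (by positivity)] at hjk
  exact_mod_cast hjk

end NormedSeqSpace.IsTailClosed

/-! ### Operators bounded on `ℓ^p` and on `ℓ^q` -/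

section Operators

variable {𝕜 : Type*} [RCLike 𝕜] {p q : ℝ} {V : Submodule 𝕜 (ℕ → 𝕜)} {T : V →ₗ[𝕜] V} {Cp Cq : ℝ≥0}

lemma exists_sumOff_apply_rpow_le (hp : 0 < p) (hpq : p ≤ q) (hq : 1 ≤ q)
    (hTp : EllpBoundedBy T p Cp) (hTq : EllpBoundedBy T q Cq)
    (hV : (ellp 𝕜 (ENNReal.ofReal q)).carrier ≤ V) (u : V)
    (hu : ∑' k, ‖(u : ℕ → 𝕜) k‖ₑ ^ q ≠ ∞) (G : Finset ℕ) :
    ∃ F : Finset ℕ, F.card ≤ G.card ∧ sumOff (fun k => ‖(T u : ℕ → 𝕜) k‖ₑ ^ q) F ≤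
      2 ^ (q - 1) *
        (Cp ^ (q / p) * (G.card * ((∑ k ∈ G, ‖(u : ℕ → 𝕜) k‖ₑ ^ p) / G.card) ^ (q / p)) +
          Cq * sumOff (fun k => ‖(u : ℕ → 𝕜) k‖ₑ ^ q) G) := by
  have hq0 : 0 < q := hp.trans_le hpq
  have hqp : 0 ≤ q / p := by positivity
  have hmem (A : Set ℕ) : A.indicator (u : ℕ → 𝕜) ∈ V := hV <| (mem_ellp_iff hq0 _).2 <|
    ne_top_of_le_ne_top hu <| ENNReal.tsum_le_tsum fun k => by
      gcongr
      exact enorm_indicator_le_enorm_self _ _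
  have hpow {r : ℝ} (hr : 0 < r) (A : Set ℕ) (k : ℕ) : ‖A.indicator (u : ℕ → 𝕜) k‖ₑ ^ r =
      A.indicator (fun k => ‖(u : ℕ → 𝕜) k‖ₑ ^ r) k := by
    by_cases hk : k ∈ A <;> simp [hk, hr]
  let u₁ : V := ⟨_, hmem G⟩
  let u₂ : V := ⟨_, hmem (G : Set ℕ)ᶜ⟩
  have hsplit : u = u₁ + u₂ := Subtype.ext (Set.indicator_self_add_compl (G : Set ℕ) _).symm
  have hsum₁ : ∑' k, ‖(u₁ : ℕ → 𝕜) k‖ₑ ^ p = ∑ k ∈ G, ‖(u : ℕ → 𝕜) k‖ₑ ^ p := by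
    simp only [u₁, hpow hp]
    exact (sum_eq_tsum_indicator _ _).symm
  have hsum₂ : ∑' k, ‖(u₂ : ℕ → 𝕜) k‖ₑ ^ q = sumOff (fun k => ‖(u : ℕ → 𝕜) k‖ₑ ^ q) G := by
    simp only [u₂, hpow hq0, sumOff]
  have hfin₁ : ∑ k ∈ G, ‖(u : ℕ → 𝕜) k‖ₑ ^ p ≠ ∞ :=
    ENNReal.sum_ne_top.2 fun k _ => ENNReal.rpow_ne_top_of_nonneg hp.le enorm_ne_top
  have hle₁ := hTp u₁ (hsum₁.trans_ne hfin₁)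
  have hle₂ := hTq u₂ (hsum₂.trans_ne (ne_top_of_le_ne_top hu (sumOff_le_tsum _ G)))
  rw [hsum₁] at hle₁
  rw [hsum₂] at hle₂
  have hadd : (fun k => ‖(T u : ℕ → 𝕜) k‖ₑ) ≤
      (fun k => ‖(T u₁ : ℕ → 𝕜) k‖ₑ) + fun k => ‖(T u₂ : ℕ → 𝕜) k‖ₑ := fun k => by
    rw [hsplit, map_add]
    exact enorm_add_le _ _
  obtain ⟨F, hF, hle⟩ := exists_sumOff_rpow_le_of_le_add hp hpq hq hadd
    (ENNReal.mul_ne_top ENNReal.coe_ne_top hfin₁) hle₁ hle₂ (n := G.card) fun hG => by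
      simp [Finset.card_eq_zero.1 hG]
  refine ⟨F, hF, hle.trans_eq ?_⟩
  rw [mul_div_assoc, ENNReal.mul_rpow_of_nonneg _ _ hqp, mul_left_comm]

/-- The splitting of `u` into its `n` largest terms and the rest is the near-optimal one for the
K-functional; the majorant `y` controls both parts. -/
lemma tailDominated_apply_rpow (hp : 0 < p) (hpq : p ≤ q) (hq : 1 ≤ q)
    (hTp : EllpBoundedBy T p Cp) (hTq : EllpBoundedBy T q Cq)
    (hV : (ellp 𝕜 (ENNReal.ofReal q)).carrier ≤ V) (u : V)
    (hu : ∑' k, ‖(u : ℕ → 𝕜) k‖ₑ ^ q ≠ ∞) {σ : ℕ → ℕ}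
    (hσ : IsDecreasingEnumeration (fun k => ‖(u : ℕ → 𝕜) k‖ₑ) σ) {m : ℕ} (hm : m ≠ 0)
    (hpm : p = (2 * m : ℝ)⁻¹) {y : ℕ → 𝕜}
    (hy : IsDilationMajorant m (fun i => ‖(u : ℕ → 𝕜) (σ i)‖₊) fun k => ‖y k‖₊) :
    TailDominated (fun k => ‖(T u : ℕ → 𝕜) k‖ₑ ^ q) fun k =>
      ((2 ^ (q - 1) * (Cp ^ (q / p) * 12 ^ (q / p) + Cq) : ℝ≥0) : ℝ≥0∞) * ‖y k‖ₑ ^ q := fun F => by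
  have hq0 : 0 < q := hp.trans_le hpq
  have hqp : 0 ≤ q / p := by positivity
  have hanti : Antitone fun i => ‖(u : ℕ → 𝕜) (σ i)‖₊ := fun i j hij =>
    ENNReal.coe_le_coe.1 (hσ.antitone hij)
  have hyσ (i : ℕ) : ‖(u : ℕ → 𝕜) (σ i)‖ₑ ≤ ‖y i‖ₑ := by
    have hyi := hy 0 i
    simp only [pow_zero, Nat.div_one, one_mul] at hyi
    exact ENNReal.coe_le_coe.2 hyi
  let σ' : ℕ ↪ ℕ := ⟨σ, hσ.injective⟩
  obtain ⟨F', hF', hle⟩ := exists_sumOff_apply_rpow_le hp hpq hq hTp hTq hV u hu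
    ((Finset.range F.card).map σ')
  rw [Finset.card_map, Finset.card_range, Finset.sum_map] at hle
  have hrest : sumOff (fun k => ‖(u : ℕ → 𝕜) k‖ₑ ^ q) ((Finset.range F.card).map σ') ≤
      sumOff (fun k => ‖y k‖ₑ ^ q) F := by
    rw [sumOff_map σ' fun k hk => by
      rw [hσ.eq_zero_of_notMem_range k hk, ENNReal.zero_rpow_of_pos hq0]]
    refine (sumOff_range_le_sumOff (fun i j hij => ?_) le_rfl).trans
      (sumOff_mono_left (fun i => ?_) F)
    · exact ENNReal.rpow_le_rpow (hσ.antitone hij) hq0.le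
    · exact ENNReal.rpow_le_rpow (hyσ i) hq0.le
  have hlarge := hy.mul_average_rpow_le hm hanti hpm hq0.le (le_refl F.card)
  refine ⟨F', by simpa using hF', hle.trans ?_⟩
  rw [sumOff_const_mul]
  calc _ ≤ 2 ^ (q - 1) * (Cp ^ (q / p) * (12 ^ (q / p) * sumOff (fun k => ‖y k‖ₑ ^ q) F) +
        Cq * sumOff (fun k => ‖y k‖ₑ ^ q) F) := by
        gcongr 2 ^ (q - 1) * (Cp ^ (q / p) * ?_ + Cq * ?_)
        exact hlarge
    _ = _ := by
        push_cast [ENNReal.coe_rpow_of_nonneg _ hqp,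
          ENNReal.coe_rpow_of_nonneg _ (sub_nonneg.2 hq)]
        ring

lemma restrictsBounded_ellp_toSpanSingleton {r : ℝ} (hr : 0 < r) (k : ℕ) {x : V}
    (hx : (x : ℕ → 𝕜) ∈ (ellp 𝕜 (ENNReal.ofReal r)).carrier) :
    RestrictsBounded (LinearMap.toSpanSingleton 𝕜 V x ∘ₗ LinearMap.proj k ∘ₗ V.subtype)
      (ellp 𝕜 (ENNReal.ofReal r)) := by
  refine (restrictsBounded_ellp_iff hr _).2
    ⟨(∑' i, ‖(x : ℕ → 𝕜) i‖ₑ ^ r).toNNReal, fun z _ => ?_⟩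
  rw [ENNReal.coe_toNNReal ((mem_ellp_iff hr _).1 hx), mul_comm]
  calc _ = ‖(z : ℕ → 𝕜) k‖ₑ ^ r * ∑' i, ‖(x : ℕ → 𝕜) i‖ₑ ^ r := by
        simp [ENNReal.mul_rpow_of_nonneg _ _ hr.le, ENNReal.tsum_mul_left]
    _ ≤ (∑' i, ‖(z : ℕ → 𝕜) i‖ₑ ^ r) * ∑' i, ‖(x : ℕ → 𝕜) i‖ₑ ^ r := by
        gcongr
        exact ENNReal.le_tsum k

/-- A rank-one operator carries a nonzero element of `E` to a multiple of any given element of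
`ℓ^p ∩ ℓ^q`. -/
lemma ellp_inf_ellp_le_of_restrictsBounded {E : NormedSeqSpace 𝕜} (hp : 0 < p) (hq : 0 < q)
    (hE : E.carrier ≠ ⊥)
    (hEV : E.carrier ≤ (ellp 𝕜 (ENNReal.ofReal p)).carrier ⊔ (ellp 𝕜 (ENNReal.ofReal q)).carrier)
    (hT : ∀ T : ↥((ellp 𝕜 (ENNReal.ofReal p)).carrier ⊔ (ellp 𝕜 (ENNReal.ofReal q)).carrier) →ₗ[𝕜]
      ↥((ellp 𝕜 (ENNReal.ofReal p)).carrier ⊔ (ellp 𝕜 (ENNReal.ofReal q)).carrier),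
      RestrictsBounded T (ellp 𝕜 (ENNReal.ofReal p)) →
        RestrictsBounded T (ellp 𝕜 (ENNReal.ofReal q)) → RestrictsBounded T E) :
    (ellp 𝕜 (ENNReal.ofReal p)).carrier ⊓ (ellp 𝕜 (ENNReal.ofReal q)).carrier ≤ E.carrier := by
  rintro x ⟨hxp, hxq⟩
  obtain ⟨z, hz, hz0⟩ := Submodule.exists_mem_ne_zero_of_ne_bot hE
  obtain ⟨k, hk⟩ := Function.ne_iff.1 hz0
  obtain ⟨C, hC⟩ := hT _
    (restrictsBounded_ellp_toSpanSingleton hp k (x := ⟨x, Submodule.mem_sup_left hxp⟩) hxp)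
    (restrictsBounded_ellp_toSpanSingleton hq k hxq)
  obtain ⟨hmem, -⟩ := hC ⟨z, hEV hz⟩ hz
  exact (Submodule.smul_mem_iff _ hk).1 hmem

end Operators

namespace NormedSeqSpace.IsTailClosed

variable {𝕜 : Type*} [RCLike 𝕜] {E : NormedSeqSpace 𝕜} {q : ℝ}

lemma exists_isDecreasingEnumeration_comp_mem (hE : E.IsTailClosed q) (hqb : E.IsQuasiBanach)
    (hq : 0 < q) (hEq : E.carrier ≤ (ellp 𝕜 (ENNReal.ofReal q)).carrier) :
    ∃ D, ∀ u ∈ E.carrier, ∃ σ, IsDecreasingEnumeration (fun k => ‖u k‖ₑ) σ ∧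
      u ∘ σ ∈ E.carrier ∧ E.extQnorm (u ∘ σ) ≤ D * E.extQnorm u := by
  obtain ⟨D, -, hD⟩ := hE.exists_bound hqb hq
  refine ⟨D, fun u hu => ?_⟩
  have hsum := (mem_ellp_iff hq u).1 (hEq hu)
  obtain ⟨σ, hσ⟩ := exists_isDecreasingEnumeration (φ := fun k => ‖u k‖ₑ) fun ε hε => by
    have hfin := ENNReal.finite_const_le_of_tsum_ne_top hsum (ε := ε ^ q)
      (by simp [hε.ne', hq.not_gt])
    simpa only [ENNReal.rpow_le_rpow_iff hq] using hfin
  exact ⟨σ, hσ, hE.comp_mem hu hσ.injective,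
    hD u hu _ (tailDominated_comp (fun k => ‖u k‖ₑ ^ q) hσ.injective)⟩

lemma exists_restrictsBounded (hE : E.IsTailClosed q) (hqb : E.IsQuasiBanach) (hq : 1 ≤ q)
    (hEq : E.carrier ≤ (ellp 𝕜 (ENNReal.ofReal q)).carrier) :
    ∃ p, 0 < p ∧ p < q ∧ ∀ (V : Submodule 𝕜 (ℕ → 𝕜)) (T : V →ₗ[𝕜] V),
      (ellp 𝕜 (ENNReal.ofReal q)).carrier ≤ V → RestrictsBounded T (ellp 𝕜 (ENNReal.ofReal p)) →
        RestrictsBounded T (ellp 𝕜 (ENNReal.ofReal q)) → RestrictsBounded T E := by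
  have hq0 : 0 < q := by linarith
  obtain ⟨m, hm, B, hB0, hB⟩ := hE.exists_isDilationMajorant hqb hq0
  obtain ⟨D, hD⟩ := hE.exists_isDecreasingEnumeration_comp_mem hqb hq0 hEq
  have hm1 : (1 : ℝ) ≤ m := by exact_mod_cast Nat.one_le_iff_ne_zero.2 hm
  have hp : 0 < (2 * m : ℝ)⁻¹ := by positivity
  have hpq : (2 * m : ℝ)⁻¹ < q := (inv_lt_one_of_one_lt₀ (by linarith)).trans_le hq
  refine ⟨(2 * m : ℝ)⁻¹, hp, hpq, fun V T hV hTp hTq => ?_⟩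
  obtain ⟨Cp, hTp⟩ := (restrictsBounded_ellp_iff hp T).1 hTp
  obtain ⟨Cq, hTq⟩ := (restrictsBounded_ellp_iff hq0 T).1 hTq
  obtain ⟨c, hc0, hc⟩ := hE.exists_bound_const_mul hqb hq0 (2 ^ (q - 1) *
    (Cp ^ (q / (2 * m : ℝ)⁻¹) * 12 ^ (q / (2 * m : ℝ)⁻¹) + Cq))
  refine ⟨c * (B * D), fun u hu => ?_⟩
  obtain ⟨σ, hσ, hmemσ, hleσ⟩ := hD u hu
  obtain ⟨y, hy, hle, hmaj⟩ := hB _ hmemσ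
  obtain ⟨hmem, hleT⟩ := hc y hy _ (tailDominated_apply_rpow hp hpq.le hq hTp hTq hV u
    ((mem_ellp_iff hq0 _).1 (hEq hu)) hσ hm rfl hmaj)
  refine ⟨hmem, ?_⟩
  rw [← E.extQnorm_of_mem hmem, ← E.extQnorm_of_mem hu]
  calc E.extQnorm (T u) ≤ c * E.extQnorm y := hleT
    _ ≤ c * (B * (D * E.extQnorm u)) := by
        gcongr
        exact hle.trans (mul_le_mul_of_nonneg_left hleσ hB0)
    _ = c * (B * D) * E.extQnorm u := by ring

lemma exists_isInterpolationSpace (hE : E.IsTailClosed q) (hqb : E.IsQuasiBanach) (hq : 1 ≤ q)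
    (hE_ne : E.carrier ≠ ⊥) (hEq : E.carrier ≤ (ellp 𝕜 (ENNReal.ofReal q)).carrier) :
    ∃ p, 0 < p ∧ p < q ∧
      IsInterpolationSpace (ellp 𝕜 (ENNReal.ofReal p)) (ellp 𝕜 (ENNReal.ofReal q)) E := by
  obtain ⟨p, hp, hpq, hT⟩ := hE.exists_restrictsBounded hqb hq hEq
  have hEV := hEq.trans (le_sup_right (a := (ellp 𝕜 (ENNReal.ofReal p)).carrier))
  exact ⟨p, hp, hpq, ellp_inf_ellp_le_of_restrictsBounded hp (by linarith) hE_ne hEV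
    fun T => hT _ T le_sup_right, hEV, fun T => hT _ T le_sup_right⟩

end NormedSeqSpace.IsTailClosed

end SeqInterp

theorem mainTheorem2 {𝕜 : Type*} [RCLike 𝕜] (E : SeqInterp.NormedSeqSpace 𝕜)
    (hE : E.IsQuasiBanach)
    (hE_sub : E.carrier ≤ (SeqInterp.ellp 𝕜 ∞).carrier)
    (hE_ne_zero : E.carrier ≠ ⊥)
    (hE_ne_top : E.carrier ≠ (SeqInterp.ellp 𝕜 ∞).carrier)
    (q : ℝ) (hq : 1 ≤ q) :
    List.TFAE [
      ∃ p : ℝ, 0 < p ∧ p < q ∧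
        SeqInterp.IsInterpolationSpace (SeqInterp.ellp 𝕜 (ENNReal.ofReal p))
          (SeqInterp.ellp 𝕜 (ENNReal.ofReal q)) E,
      ∃ c : ℝ, 0 < c ∧ ∀ (u : E.carrier) (v : ℕ → 𝕜), v ∈ (SeqInterp.ellp 𝕜 ∞).carrier →
        SeqInterp.TailMajorizedPow q v u →
          ∃ hv : v ∈ E.carrier, E.qnorm ⟨v, hv⟩ ≤ c * E.qnorm u,
      ∀ (u : E.carrier) (v : ℕ → 𝕜), v ∈ (SeqInterp.ellp 𝕜 ∞).carrier →
        SeqInterp.TailMajorizedPow q v u → v ∈ E.carrier] := by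
  have hq0 : 0 < q := by linarith
  have hclosed (h : ∀ (u : E.carrier) (v : ℕ → 𝕜), v ∈ (SeqInterp.ellp 𝕜 ∞).carrier →
      SeqInterp.TailMajorizedPow q v u → v ∈ E.carrier) :
      E.carrier ≤ (SeqInterp.ellp 𝕜 (ENNReal.ofReal q)).carrier ∧ E.IsTailClosed q :=
    have hEq := SeqInterp.NormedSeqSpace.le_ellp_of_forall_tailMajorizedPow_mem hq0 hE_sub
      hE_ne_top h
    ⟨hEq, SeqInterp.NormedSeqSpace.isTailClosed_of_forall_tailMajorizedPow_mem hq0 hEq h⟩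
  tfae_have 1 → 3 := by
    rintro ⟨p, hp, hpq, h⟩ u v - hvu
    exact h.mem_of_tailDominated hE hp hpq.le hq u.2
      ((SeqInterp.tailMajorizedPow_iff hq0.le v u).1 hvu)
  tfae_have 2 → 3 := fun ⟨_, _, h⟩ u v hv hvu => (h u v hv hvu).1
  tfae_have 3 → 2 := fun h => by
    obtain ⟨c, hc, hbound⟩ := (hclosed h).2.exists_bound hE hq0
    refine ⟨c, hc, fun u v hv hvu => ⟨h u v hv hvu, ?_⟩⟩
    have huv := hbound u u.2 v ((SeqInterp.tailMajorizedPow_iff hq0.le v u).1 hvu)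
    rwa [E.extQnorm_of_mem (h u v hv hvu), E.extQnorm_of_mem u.2] at huv
  tfae_have 3 → 1 := fun h => by
    obtain ⟨hEq, hE_closed⟩ := hclosed h
    exact hE_closed.exists_isInterpolationSpace hE hq hE_ne_zero hEq
  tfae_finish
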